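/- Let $\nu = e^{-f}$ be a probability density on $\mathbb{R}^n$, where $f\colon \mathbb{R}^n \to \mathbb{R}$ is differentiable and $\nabla f$ is $L$-Lipschitz, $L > 0$. The Proximal Langevin Algorithm (PLA) with step size $\epsilon > 0$ starts from any random variable $x_0 \in \mathbb{R}^n$ and produces iterates satisfying $$x_{k+1} = x_k - \epsilon \nabla f(x_{k+1}) + \sqrt{2\epsilon}\, z_k, \qquad k \ge 0,$$ where $z_k \sim \mathcal{N}(0,I)$ is independent of $x_0,\dots,x_k$. Let $\rho_k$ be the law of $x_k$. Let $\nu_\epsilon$ be a biased limit of PLA with step size $\epsilon$, i.e. a probability measure which is the weak limit, as $k\to\infty$, of the laws of the iterates of PLA from some starting distribution (not necessarily $\rho_0$). For $q > 1$ and probability measures $\rho,\mu$ let $$R_{q,\mu}(\rho) = \frac{1}{q-1} \log \int \Big(\frac{d\rho}{d\mu}\Big)^{q} d\mu \in [0,\infty]$$ be the Rényi divergence of order $q$ of $\rho$ with respect to $\mu$, equal to $+\infty$ if $\rho \not\ll \mu$. Suppose that $\nu_\epsilon$ satisfies the Poincaré inequality with constant $\beta > 0$, that is, $\mathrm{Var}_{\nu_\epsilon}(g)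 \le \frac{1}{\beta}\, \mathbb{E}_{\nu_\epsilon}[\|\nabla g\|^2]$ for all smooth $g\colon\mathbb{R}^n\to\mathbb{R}$ with $g$ and $\nabla g$ square-integrable under $\nu_\epsilon$, that $0 < \epsilon < \min\{\frac1L, \frac{1}{2\beta}\}$, that $q > 1$, and that $R_{2q,\nu_\epsilon}(\rho_0) < \infty$. Set $$k_0 = \frac{2q}{\beta\epsilon}\big(R_{2q,\nu_\epsilon}(\rho_0) - 1\big) \in \mathbb{R}.$$ Then for every integer $k \ge 0$ with $k \ge k_0$, $$R_{q,\nu}(\rho_k) \le \Big(\frac{q-\frac12}{q-1}\Big)\, e^{-\frac{\beta\epsilon (k-k_0)}{2q}} + R_{2q-1,\nu}(\nu_\epsilon),$$ as an inequality in $[0,\infty]$. -/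

import Mathlib

open MeasureTheory ProbabilityTheory Filter Topology
open scoped ENNReal ContDiff Gradient

noncomputable section

/-- The measure `e^{-f} dx` on `ℝⁿ`. -/
def gibbsMeasure {n : ℕ} (f : EuclideanSpace ℝ (Fin n) → ℝ) :
    Measure (EuclideanSpace ℝ (Fin n)) :=
  volume.withDensity (fun x => ENNReal.ofReal (Real.exp (-f x)))

/-- The potential `f` is differentiable with `L`-Lipschitz gradient, i.e. `ν = e^{-f}` is
`(L, ∞)`-smooth: no condition is put on higher derivatives. -/
structure IsLSmooth {n : ℕ} (f : EuclideanSpace ℝ (Fin n) → ℝ) (L : ℝ) : Prop where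
  differentiable : Differentiable ℝ f
  gradient_lipschitz : ∀ x y, ‖∇ f x - ∇ f y‖ ≤ L * ‖x - y‖

open Classical in
/-- The Rényi divergence `R_{q,ν}(ρ) = (q - 1)⁻¹ log ∫ (dρ/dν)^q dν` of order `q > 1` of `ρ` with
respect to `ν`, with values in the extended reals. For measures with Lebesgue densities the integral
is `∫ ρ(x)^q / ν(x)^(q-1) dx`. The value is `+∞` if the integral diverges or if `ρ` is not
absolutely continuous with respect to `ν`. -/
def renyiDiv {E : Type*} [MeasurableSpace E] (q : ℝ) (ρ ν : Measure E) : EReal :=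
  if ρ ≪ ν then ((1 / (q - 1) : ℝ) : EReal) * ENNReal.log (∫⁻ x, (ρ.rnDeriv ν x) ^ q ∂ν) else ⊤

/-- The Poincaré inequality with constant `α`: `Var_μ(g) ≤ α⁻¹ E_μ[‖∇g‖²]` for all smooth `g` for
which both sides are finite integrals. -/
def SatisfiesPoincare {n : ℕ} (μ : Measure (EuclideanSpace ℝ (Fin n))) (α : ℝ) : Prop :=
  ∀ g : EuclideanSpace ℝ (Fin n) → ℝ, ContDiff ℝ ∞ g → MemLp g 2 μ → MemLp (∇ g) 2 μ →
    ((∫ x, g x ^ 2 ∂μ) - (∫ x, g x ∂μ) ^ 2) ≤ (1 / α) * ∫ x, ‖∇ g x‖ ^ 2 ∂μ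

/-- The random variables `x₀, x₁, …` are iterates of the Proximal Langevin Algorithm for the
potential `f` with step size `ε`, driven by the noise `z₀, z₁, …`: each `z_k` is standard Gaussian
and independent of the past `(x₀, …, x_k)`, and `x_{k+1}` solves the implicit equation
`x_{k+1} = x_k - ε ∇f(x_{k+1}) + √(2ε) z_k`. -/
structure IsPLA {n : ℕ} (f : EuclideanSpace ℝ (Fin n) → ℝ) (ε : ℝ)
    {Ω : Type*} [MeasurableSpace Ω] (P : Measure Ω)
    (x z : ℕ → Ω → EuclideanSpace ℝ (Fin n)) : Prop where
  measurable : ∀ k, Measurable (x k)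
  noise_law : ∀ k, HasLaw (z k) (stdGaussian (EuclideanSpace ℝ (Fin n))) P
  noise_indep : ∀ k, IndepFun (fun w (i : Fin (k + 1)) => x i w) (z k) P
  update : ∀ k, ∀ᵐ w ∂P,
    x (k + 1) w = x k w - ε • ∇ f (x (k + 1) w) + Real.sqrt (2 * ε) • z k w

/-- `νε` is a biased limit of the Proximal Langevin Algorithm with step size `ε`: the laws of the
iterates, started from some initial distribution, converge weakly to `νε`. (Any stationary
distribution of the algorithm is one: start from it.) -/
def IsBiasedLimit {n : ℕ} (f : EuclideanSpace ℝ (Fin n) → ℝ) (ε : ℝ)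
    (νε : ProbabilityMeasure (EuclideanSpace ℝ (Fin n))) : Prop :=
  ∃ (Ω : Type) (_ : MeasurableSpace Ω) (P : Measure Ω) (_ : IsProbabilityMeasure P)
    (x z : ℕ → Ω → EuclideanSpace ℝ (Fin n))
    (ρ : ℕ → ProbabilityMeasure (EuclideanSpace ℝ (Fin n))),
    IsPLA f ε P x z ∧ (∀ k, HasLaw (x k) (ρ k : Measure (EuclideanSpace ℝ (Fin n))) P) ∧
      Tendsto ρ atTop (𝓝 νε)

end

/-! ### Exponential moments and translations of the standard Gaussian. -/

section GaussianPrelim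

variable {E : Type*} [NormedAddCommGroup E] [InnerProductSpace ℝ E] [FiniteDimensional ℝ E]
  [MeasurableSpace E] [BorelSpace E]

/-! The implicit update says e(x_{k+1}) = x_k + √(2ε) z_k with e = id + ε∇f. Since εL < 1, e is a
homeomorphism (`exists_homeomorph_id_add_smul`), so one step convolves the law with N(0, 2εI) and
pushes the result forward by e⁻¹ (`IsPLA.map_succ`). This kernel maps bounded continuous functions
to bounded continuous functions, so the weak limit ν_ε is stationary
(`map_gaussConv_eq_of_tendsto`). A pushforward by e⁻¹ leaves Rényi integrals unchanged. Everything
therefore reduces to the decrease of the divergence of order p = 2q when both measures are convolved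
with the same Gaussian (`renyi_gaussConv`); stationarity brings the reference measure, and with it
the Poincaré constant, back to that of ν_ε after each iteration.

For this decrease the Gaussian is cut into many small ones of variance σ², along which the Poincaré
constant C grows by at most σ²π²/8 each (`PoincareC1.gaussConv`). In a small step let P be the
Gaussian smoothing, h and h' the densities before and after, V and V' their p-th moments, r the
exponent conjugate to p, and g = h'^(p-1). Duality and Hölder give V' = ∫ h·Pg dμ ≤ V^(1/p) W^(1/r)
with W = ∫ (Pg)^r dμ, while V' = ∫ P(g^r) dμ. So the Jensen gap V' - W controls the drop of the
divergence. `exists_gap_bounds` and `jensen_gap_ge` bound the gap below through the Poincaré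
inequality and the variance of h'^(p/2), which is at least V'(1 - e^(-R')) by interpolation
(`sq_integral_rpow_half_le`).

The outcome is R' + (e^z - 1) min(1, R') ≤ R with z = (5/6)σ²/(Cp): linear decrease while R' ≥ 1,
geometric decrease below. The profile `linExp` absorbs both regimes, since R ≤ linExp θ implies R' ≤
linExp (θ - z) (`le_linExp_sub`), and over one iteration the z's add up to at least βε/p
(`sum_step_ge`). Starting from θ = R₀ - 1, after k iterations θ = -βε(k - k₀)/(2q), which is
nonpositive exactly when k ≥ k₀; there linExp is exp. A Cauchy–Schwarz triangle inequality
(`renyiDiv_le_of_lintegral_le`) passes from ν_ε to ν. -/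

lemma integral_cexp_inner_stdGaussian (t v : E) :
    ∫ z, Complex.exp ((inner ℝ z t : ℝ) * Complex.I + (inner ℝ z v : ℝ)) ∂(stdGaussian E)
      = Complex.exp (-‖t‖ ^ 2 / 2 + ‖v‖ ^ 2 / 2 + (inner ℝ v t : ℝ) * Complex.I) := by
  have h1 : ∀ w : ℂ, ∫ x : ℝ, Complex.exp (w * x) ∂(gaussianReal 0 1) = Complex.exp (w ^ 2 / 2) := by
    intro w
    have := complexMGF_gaussianReal (p := gaussianReal 0 1) (X := id) (μ := 0) (v := 1)
      (by simp) w
    simpa [complexMGF] using this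
  rw [stdGaussian, integral_map (Measurable.aemeasurable (by fun_prop))
    (Measurable.aestronglyMeasurable (by fun_prop))]
  set b := stdOrthonormalBasis ℝ E
  have h2 : ∀ x : Fin (Module.finrank ℝ E) → ℝ,
      Complex.exp ((inner ℝ (∑ i, x i • b i) t : ℝ) * Complex.I
        + (inner ℝ (∑ i, x i • b i) v : ℝ))
      = ∏ i, Complex.exp (((inner ℝ (b i) t : ℝ) * Complex.I + (inner ℝ (b i) v : ℝ)) * x i) := by
    intro x
    rw [← Complex.exp_sum]
    congr 1
    simp_rw [sum_inner, real_inner_smul_left]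
    push_cast
    rw [Finset.sum_mul, ← Finset.sum_add_distrib]
    exact Finset.sum_congr rfl fun i _ => by ring
  simp_rw [h2]
  rw [integral_fintype_prod_eq_prod (f := fun i (x : ℝ) =>
    Complex.exp (((inner ℝ (b i) t : ℝ) * Complex.I + (inner ℝ (b i) v : ℝ)) * x))]
  simp_rw [h1]
  rw [← Complex.exp_sum]
  congr 1
  have e1 : ((‖t‖ ^ 2 : ℝ) : ℂ) = ∑ i, ((inner ℝ (b i) t : ℝ) : ℂ) ^ 2 := by
    rw [← b.sum_sq_inner_right t]; push_cast; rfl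
  have e2 : ((‖v‖ ^ 2 : ℝ) : ℂ) = ∑ i, ((inner ℝ (b i) v : ℝ) : ℂ) ^ 2 := by
    rw [← b.sum_sq_inner_right v]; push_cast; rfl
  have e3 : ((inner ℝ v t : ℝ) : ℂ) = ∑ i, ((inner ℝ (b i) v : ℝ) : ℂ) * (inner ℝ (b i) t : ℝ) := by
    rw [← b.sum_inner_mul_inner v t]
    push_cast
    exact Finset.sum_congr rfl fun i _ => by rw [real_inner_comm]
  push_cast at e1 e2
  rw [e1, e2, e3, ← Finset.sum_neg_distrib, Finset.sum_div, Finset.sum_div, Finset.sum_mul,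
    ← Finset.sum_add_distrib, ← Finset.sum_add_distrib]
  refine Finset.sum_congr rfl fun i _ => ?_
  ring_nf
  rw [Complex.I_sq]
  ring

lemma integrable_exp_norm_stdGaussian (c : ℝ) :
    Integrable (fun z : E => Real.exp (c * ‖z‖)) (stdGaussian E) := by
  obtain ⟨C, hC, hi⟩ := IsGaussian.exists_integrable_exp_sq (stdGaussian E)
  refine (hi.const_mul (Real.exp (c ^ 2 / (4 * C)))).mono' (by fun_prop) ?_
  refine .of_forall fun z => ?_
  rw [Real.norm_eq_abs, abs_of_pos (Real.exp_pos _), ← Real.exp_add]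
  refine Real.exp_le_exp.2 ?_
  have : c ^ 2 / (4 * C) + C * ‖z‖ ^ 2 - c * ‖z‖ = (c - 2 * C * ‖z‖) ^ 2 / (4 * C) := by
    field_simp; ring
  have h2 : 0 ≤ (c - 2 * C * ‖z‖) ^ 2 / (4 * C) := by positivity
  linarith

lemma integrable_exp_inner_stdGaussian (v : E) :
    Integrable (fun z : E => Real.exp (inner ℝ z v)) (stdGaussian E) := by
  refine (integrable_exp_norm_stdGaussian ‖v‖).mono' (by fun_prop) (.of_forall fun z => ?_)
  rw [Real.norm_eq_abs, abs_of_pos (Real.exp_pos _)]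
  refine Real.exp_le_exp.2 ?_
  rw [mul_comm]
  exact real_inner_le_norm z v

lemma integral_exp_inner_stdGaussian (v : E) :
    ∫ z : E, Real.exp (inner ℝ z v) ∂(stdGaussian E) = Real.exp (‖v‖ ^ 2 / 2) := by
  have h := integral_cexp_inner_stdGaussian (0 : E) v
  simp only [inner_zero_right, Complex.ofReal_zero, zero_mul, zero_add, norm_zero] at h
  have h2 : ∀ z : E, Complex.exp ((inner ℝ z v : ℝ) : ℂ)
      = ((Real.exp (inner ℝ z v) : ℝ) : ℂ) := fun z => by push_cast; rfl
  simp_rw [h2] at h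
  rw [integral_complex_ofReal] at h
  have h3 : Complex.exp (-(0 : ℂ) ^ 2 / 2 + (‖v‖ : ℂ) ^ 2 / 2 + 0)
    = ((Real.exp (‖v‖ ^ 2 / 2) : ℝ) : ℂ) := by push_cast; simp
  rw [h3] at h
  exact_mod_cast h

/-- The Cameron–Martin formula for the standard Gaussian measure. -/
lemma map_add_stdGaussian (v : E) :
    (stdGaussian E).map (fun z => z + v) = (stdGaussian E).withDensity
      (fun z => ENNReal.ofReal (Real.exp (inner ℝ z v - ‖v‖ ^ 2 / 2))) := by
  have hint : Integrable (fun z : E => Real.exp (inner ℝ z v - ‖v‖ ^ 2 / 2)) (stdGaussian E) := by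
    simp_rw [sub_eq_add_neg, Real.exp_add]
    exact (integrable_exp_inner_stdGaussian v).mul_const _
  have : IsFiniteMeasure ((stdGaussian E).withDensity
      (fun z => ENNReal.ofReal (Real.exp (inner ℝ z v - ‖v‖ ^ 2 / 2)))) :=
    isFiniteMeasure_withDensity_ofReal hint.2
  have : IsFiniteMeasure ((stdGaussian E).map (fun z => z + v)) := by
    exact Measure.isFiniteMeasure_map _ _
  have hc : CompleteSpace E := FiniteDimensional.complete ℝ E
  -- Both characteristic functions are instances of the mixed exponential formula: one with zero
  -- tilt and a phase, the other with tilt v.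
  refine Measure.ext_of_charFun ?_
  ext t
  rw [charFun_apply, charFun_apply, integral_map (by fun_prop)
    (Measurable.aestronglyMeasurable (by fun_prop)),
    integral_withDensity_eq_integral_toReal_smul (by fun_prop) (.of_forall fun _ => by simp)]
  have e1 : ∀ z : E, Complex.exp ((inner ℝ (z + v) t : ℝ) * Complex.I)
      = Complex.exp ((inner ℝ v t : ℝ) * Complex.I)
        * Complex.exp ((inner ℝ z t : ℝ) * Complex.I + (inner ℝ z (0 : E) : ℝ)) := by
    intro z
    rw [← Complex.exp_add, inner_add_left]
    congr 1
    push_cast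
    simp
    ring
  have e2 : ∀ z : E, (ENNReal.ofReal (Real.exp (inner ℝ z v - ‖v‖ ^ 2 / 2))).toReal
        • Complex.exp ((inner ℝ z t : ℝ) * Complex.I)
      = Complex.exp (-‖v‖ ^ 2 / 2)
        * Complex.exp ((inner ℝ z t : ℝ) * Complex.I + (inner ℝ z v : ℝ)) := by
    intro z
    rw [ENNReal.toReal_ofReal (Real.exp_pos _).le, Complex.real_smul, Complex.ofReal_exp,
      ← Complex.exp_add, ← Complex.exp_add]
    congr 1
    push_cast
    ring
  simp_rw [e1, e2]
  rw [integral_const_mul, integral_const_mul, integral_cexp_inner_stdGaussian,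
    integral_cexp_inner_stdGaussian, ← Complex.exp_add, ← Complex.exp_add]
  congr 1
  simp
  ring

lemma integral_comp_add_stdGaussian {G : Type*} [NormedAddCommGroup G] [NormedSpace ℝ G]
    (F : E → G) (v : E) :
    ∫ z, F (z + v) ∂(stdGaussian E)
      = ∫ z, Real.exp (inner ℝ z v - ‖v‖ ^ 2 / 2) • F z ∂(stdGaussian E) := by
  have h : ∫ z, F z ∂((stdGaussian E).map (fun z => z + v)) = ∫ z, F (z + v) ∂(stdGaussian E) :=
    (Homeomorph.addRight v).measurableEmbedding.integral_map F
  rw [← h, map_add_stdGaussian,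
    integral_withDensity_eq_integral_toReal_smul (by fun_prop) (.of_forall fun _ => by simp)]
  refine integral_congr_ae (.of_forall fun z => ?_)
  simp only [ENNReal.toReal_ofReal (Real.exp_pos _).le]

lemma integrable_norm_mul_exp_norm_stdGaussian (c : ℝ) (k : ℕ) :
    Integrable (fun z : E => ‖z‖ ^ k * Real.exp (c * ‖z‖)) (stdGaussian E) := by
  refine (integrable_exp_norm_stdGaussian (k + c)).mono' (by fun_prop) (.of_forall fun z => ?_)
  rw [Real.norm_eq_abs, abs_of_nonneg (by positivity), add_mul, Real.exp_add]
  refine mul_le_mul_of_nonneg_right ?_ (Real.exp_pos _).le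
  have : ‖z‖ ≤ Real.exp ‖z‖ := by linarith [Real.add_one_le_exp ‖z‖]
  rw [Real.exp_nat_mul]
  gcongr

lemma integrable_norm_pow_stdGaussian (k : ℕ) :
    Integrable (fun z : E => ‖z‖ ^ k) (stdGaussian E) := by
  simpa using integrable_norm_mul_exp_norm_stdGaussian (E := E) 0 k

lemma integrable_inner_stdGaussian (v : E) :
    Integrable (fun z : E => (inner ℝ z v : ℝ)) (stdGaussian E) := by
  refine ((integrable_norm_pow_stdGaussian (E := E) 1).mul_const ‖v‖).mono' (by fun_prop)
    (.of_forall fun z => ?_)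
  simpa using abs_real_inner_le_norm z v

lemma integral_inner_stdGaussian (v : E) :
    ∫ z : E, (inner ℝ z v : ℝ) ∂(stdGaussian E) = 0 := by
  have hc : CompleteSpace E := FiniteDimensional.complete ℝ E
  have := integral_strongDual_stdGaussian (innerSL ℝ v)
  simpa [real_inner_comm] using this

lemma integrable_inner_sq_stdGaussian (v : E) :
    Integrable (fun z : E => (inner ℝ z v : ℝ) ^ 2) (stdGaussian E) := by
  refine ((integrable_norm_pow_stdGaussian (E := E) 2).mul_const (‖v‖ ^ 2)).mono' (by fun_prop)
    (.of_forall fun z => ?_)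
  rw [Real.norm_eq_abs, abs_of_nonneg (sq_nonneg _), ← mul_pow, ← sq_abs]
  gcongr
  exact abs_real_inner_le_norm z v

lemma integral_inner_sq_stdGaussian (v : E) :
    ∫ z : E, (inner ℝ z v : ℝ) ^ 2 ∂(stdGaussian E) = ‖v‖ ^ 2 := by
  have hc : CompleteSpace E := FiniteDimensional.complete ℝ E
  have h := variance_dual_stdGaussian (innerSL ℝ v)
  rw [variance_eq_integral (by fun_prop), integral_strongDual_stdGaussian] at h
  simpa [real_inner_comm] using h

end GaussianPrelim

/-! ### Gaussian smoothing of functions and its gradient. -/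

section GaussSmooth

variable {E : Type*} [NormedAddCommGroup E] [InnerProductSpace ℝ E] [FiniteDimensional ℝ E]
  [MeasurableSpace E] [BorelSpace E]

/-- The average of `F` over a Gaussian of standard deviation `σ` centred at `x`. -/
noncomputable def gaussSmooth (σ : ℝ) (F : E → ℝ) (x : E) : ℝ :=
  ∫ z, F (x + σ • z) ∂(stdGaussian E)

/-- The law of `X + σ Z`, with `X` of law `μ` and `Z` an independent standard Gaussian. -/
noncomputable def gaussConv (σ : ℝ) (μ : Measure E) : Measure E :=
  μ ∗ (stdGaussian E).map (fun z => σ • z)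

instance isProbabilityMeasure_map_smul_stdGaussian (σ : ℝ) :
    IsProbabilityMeasure ((stdGaussian E).map (fun z => σ • z)) :=
  Measure.isProbabilityMeasure_map (by fun_prop)

instance isProbabilityMeasure_gaussConv (σ : ℝ) (μ : Measure E) [IsProbabilityMeasure μ] :
    IsProbabilityMeasure (gaussConv σ μ) := by
  unfold gaussConv; infer_instance

instance isFiniteMeasure_gaussConv (σ : ℝ) (μ : Measure E) [IsFiniteMeasure μ] :
    IsFiniteMeasure (gaussConv σ μ) := by
  unfold gaussConv; infer_instance

lemma lintegral_gaussConv (σ : ℝ) (μ : Measure E) {F : E → ℝ≥0∞} (hF : Measurable F) :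
    ∫⁻ y, F y ∂(gaussConv σ μ) = ∫⁻ x, ∫⁻ z, F (x + σ • z) ∂(stdGaussian E) ∂μ := by
  rw [gaussConv, Measure.lintegral_conv hF]
  refine lintegral_congr fun x => ?_
  rw [lintegral_map (by fun_prop) (by fun_prop)]

lemma integrable_of_abs_le {α : Type*} [MeasurableSpace α] {μ : Measure α} [IsFiniteMeasure μ]
    {F : α → ℝ} (hF : Measurable F) {B : ℝ} (hB : ∀ x, |F x| ≤ B) : Integrable F μ :=
  Integrable.of_bound hF.aestronglyMeasurable B (.of_forall hB)

lemma integral_gaussConv (σ : ℝ) (μ : Measure E) [IsFiniteMeasure μ] {F : E → ℝ}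
    (hF : Measurable F) {B : ℝ} (hB : ∀ x, |F x| ≤ B) :
    ∫ y, F y ∂(gaussConv σ μ) = ∫ x, gaussSmooth σ F x ∂μ := by
  have hi : Integrable F (gaussConv σ μ) := integrable_of_abs_le hF hB
  rw [gaussConv] at hi ⊢
  rw [integral_conv hi]
  refine integral_congr_ae (.of_forall fun x => ?_)
  simp only [gaussSmooth]
  rw [integral_map (by fun_prop) (Measurable.aestronglyMeasurable (by fun_prop))]

lemma integrable_comp_add_smul_stdGaussian (σ : ℝ) {F : E → ℝ}
    (hF : Measurable F) {B : ℝ} (hB : ∀ x, |F x| ≤ B) (x : E) :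
    Integrable (fun z => F (x + σ • z)) (stdGaussian E) :=
  integrable_of_abs_le (by fun_prop) fun _ => hB _

lemma abs_gaussSmooth_le (σ : ℝ) {F : E → ℝ} {B : ℝ} (hB : ∀ x, |F x| ≤ B) (x : E) :
    |gaussSmooth σ F x| ≤ B := by
  have := norm_integral_le_of_norm_le_const (μ := stdGaussian E) (C := B)
    (f := fun z => F (x + σ • z)) (.of_forall fun z => by simpa using hB _)
  simpa [gaussSmooth] using this

lemma gaussSmooth_le (σ : ℝ) {F : E → ℝ} (hF : Measurable F) {B : ℝ} (hB : ∀ x, |F x| ≤ B)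
    {c : ℝ} (hc : ∀ x, F x ≤ c) (x : E) : gaussSmooth σ F x ≤ c := by
  have := integral_mono (integrable_comp_add_smul_stdGaussian σ hF hB x)
    (integrable_const c) fun z => hc (x + σ • z)
  simpa [gaussSmooth] using this

lemma le_gaussSmooth (σ : ℝ) {F : E → ℝ} (hF : Measurable F) {B : ℝ} (hB : ∀ x, |F x| ≤ B)
    {c : ℝ} (hc : ∀ x, c ≤ F x) (x : E) : c ≤ gaussSmooth σ F x := by
  have := integral_mono (integrable_const c) (integrable_comp_add_smul_stdGaussian σ hF hB x)
    fun z => hc (x + σ • z)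
  simpa [gaussSmooth] using this

lemma measurable_gaussSmooth (σ : ℝ) {F : E → ℝ} (hF : Measurable F) :
    Measurable (gaussSmooth σ F) := by
  have : StronglyMeasurable (fun x : E => ∫ z, F (x + σ • z) ∂(stdGaussian E)) := by
    refine StronglyMeasurable.integral_prod_right' (f := fun p : E × E => F (p.1 + σ • p.2)) ?_
    exact (hF.comp (by fun_prop)).stronglyMeasurable
  exact this.measurable

/-- The vector `E[F(x + σ Z) Z]`, which is `σ` times the gradient of `gaussSmooth σ F`. -/
noncomputable def gaussMoment (σ : ℝ) (F : E → ℝ) (x : E) : E :=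
  ∫ z, F (x + σ • z) • z ∂(stdGaussian E)

lemma integrable_smul_stdGaussian {F : E → ℝ} (hF : Measurable F) {B : ℝ}
    (hB : ∀ x, |F x| ≤ B) : Integrable (fun z : E => F z • z) (stdGaussian E) := by
  refine ((integrable_norm_pow_stdGaussian (E := E) 1).const_mul B).mono' (by fun_prop)
    (.of_forall fun z => ?_)
  rw [norm_smul, pow_one]
  exact mul_le_mul_of_nonneg_right (hB z) (norm_nonneg z)

lemma inner_gaussMoment (σ : ℝ) {F : E → ℝ} (hF : Measurable F) {B : ℝ} (hB : ∀ x, |F x| ≤ B)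
    (x v : E) :
    inner ℝ v (gaussMoment σ F x) = ∫ z, F (x + σ • z) * inner ℝ z v ∂(stdGaussian E) := by
  have hc : CompleteSpace E := FiniteDimensional.complete ℝ E
  rw [gaussMoment]
  have := (innerSL ℝ v).integral_comp_comm (μ := stdGaussian E) (φ := fun z => F (x + σ • z) • z)
    (integrable_smul_stdGaussian (F := fun z => F (x + σ • z)) (by fun_prop) fun z => hB _)
  rw [innerSL_apply_apply] at this
  rw [← this]
  refine integral_congr_ae (.of_forall fun z => ?_)
  simp [real_inner_comm]

lemma gaussSmooth_eq_one (σ : ℝ) (hσ : σ ≠ 0) (F : E → ℝ) (x : E) :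
    gaussSmooth σ F x = gaussSmooth 1 (fun z => F (σ • z)) (σ⁻¹ • x) := by
  simp only [gaussSmooth, smul_add, smul_smul, mul_inv_cancel₀ hσ, one_smul]

lemma gaussMoment_eq_one (σ : ℝ) (hσ : σ ≠ 0) (F : E → ℝ) (x : E) :
    gaussMoment σ F x = gaussMoment 1 (fun z => F (σ • z)) (σ⁻¹ • x) := by
  simp only [gaussMoment, smul_add, smul_smul, mul_inv_cancel₀ hσ, one_smul]

/-- Cameron–Martin moves x from the argument of F into a smooth weight, so the smoothing can be
differentiated in x for merely measurable F. -/
lemma gaussSmooth_one_eq (F : E → ℝ) (x : E) :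
    gaussSmooth 1 F x = ∫ z, Real.exp (inner ℝ z x - ‖x‖ ^ 2 / 2) • F z ∂(stdGaussian E) := by
  rw [← integral_comp_add_stdGaussian]
  simp only [gaussSmooth, one_smul, add_comm]

lemma gaussMoment_one_eq (F : E → ℝ) (x : E) :
    gaussMoment 1 F x
      = ∫ z, Real.exp (inner ℝ z x - ‖x‖ ^ 2 / 2) • (F z • (z - x)) ∂(stdGaussian E) := by
  rw [← integral_comp_add_stdGaussian (fun z => F z • (z - x))]
  simp only [gaussMoment, one_smul, add_sub_cancel_right, add_comm x]

lemma norm_exp_smul_smul_sub_le {F : E → ℝ} {B : ℝ} (hB : ∀ x, |F x| ≤ B) {x₀ x : E}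
    (hx : x ∈ Metric.ball x₀ 1) (z : E) :
    ‖Real.exp (inner ℝ z x - ‖x‖ ^ 2 / 2) • (F z • (z - x))‖
      ≤ B * (‖z‖ ^ 1 * Real.exp ((‖x₀‖ + 1) * ‖z‖)
        + (‖x₀‖ + 1) * Real.exp ((‖x₀‖ + 1) * ‖z‖)) := by
  have hxn : ‖x‖ ≤ ‖x₀‖ + 1 := by
    have h1 := norm_le_norm_add_norm_sub' x x₀
    have h2 : ‖x - x₀‖ < 1 := by simpa [dist_eq_norm] using hx
    linarith
  rw [norm_smul, norm_smul, Real.norm_eq_abs, Real.norm_eq_abs, abs_of_pos (Real.exp_pos _)]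
  have h1 : Real.exp (inner ℝ z x - ‖x‖ ^ 2 / 2) ≤ Real.exp ((‖x₀‖ + 1) * ‖z‖) := by
    refine Real.exp_le_exp.2 ?_
    have h2 := real_inner_le_norm z x
    have h3 : ‖z‖ * ‖x‖ ≤ ‖z‖ * (‖x₀‖ + 1) := by gcongr
    nlinarith [sq_nonneg ‖x‖]
  have h4 : ‖z - x‖ ≤ ‖z‖ + (‖x₀‖ + 1) := (norm_sub_le z x).trans (by linarith)
  have hB0 : 0 ≤ B := (abs_nonneg _).trans (hB 0)
  calc Real.exp (inner ℝ z x - ‖x‖ ^ 2 / 2) * (|F z| * ‖z - x‖)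
      ≤ Real.exp ((‖x₀‖ + 1) * ‖z‖) * (B * (‖z‖ + (‖x₀‖ + 1))) := by
        gcongr
        exact hB z
    _ = _ := by ring

lemma integrable_smoothing_bound (B : ℝ) (x₀ : E) :
    Integrable (fun z : E => B * (‖z‖ ^ 1 * Real.exp ((‖x₀‖ + 1) * ‖z‖)
        + (‖x₀‖ + 1) * Real.exp ((‖x₀‖ + 1) * ‖z‖))) (stdGaussian E) :=
  ((integrable_norm_mul_exp_norm_stdGaussian _ 1).add
    ((integrable_exp_norm_stdGaussian _).const_mul _)).const_mul B

/-- The weight exp(⟨z, x⟩ - ‖x‖²/2) has gradient z - x times itself; translating back turns the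
factor z - x into z. -/
lemma hasFDerivAt_gaussSmooth_one {F : E → ℝ} (hF : Measurable F) {B : ℝ}
    (hB : ∀ x, |F x| ≤ B) (x₀ : E) :
    HasFDerivAt (gaussSmooth 1 F) (innerSL ℝ (gaussMoment 1 F x₀)) x₀ := by
  have hc : CompleteSpace E := FiniteDimensional.complete ℝ E
  have hfun : gaussSmooth 1 F
      = fun x => ∫ z, Real.exp (inner ℝ z x - ‖x‖ ^ 2 / 2) • F z ∂(stdGaussian E) :=
    funext fun x => gaussSmooth_one_eq F x
  rw [hfun, gaussMoment_one_eq]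
  have hint : Integrable (fun z => Real.exp (inner ℝ z x₀ - ‖x₀‖ ^ 2 / 2) • (F z • (z - x₀)))
      (stdGaussian E) :=
    (integrable_smoothing_bound B x₀).mono' (by fun_prop)
      (.of_forall fun z => norm_exp_smul_smul_sub_le hB (Metric.mem_ball_self one_pos) z)
  rw [← (innerSL ℝ).integral_comp_comm hint]
  refine hasFDerivAt_integral_of_dominated_of_fderiv_le
    (F' := fun x z => innerSL ℝ (Real.exp (inner ℝ z x - ‖x‖ ^ 2 / 2) • (F z • (z - x))))
    (Metric.ball_mem_nhds x₀ one_pos)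
    (.of_forall fun x => Measurable.aestronglyMeasurable (by fun_prop)) ?_ ?_
    (.of_forall fun z x hx => ?_) (integrable_smoothing_bound B x₀)
    (.of_forall fun z x hx => ?_)
  · have h1 : Integrable (fun z => Real.exp (inner ℝ z x₀ - ‖x₀‖ ^ 2 / 2)) (stdGaussian E) := by
      simp_rw [sub_eq_add_neg, Real.exp_add]
      exact (integrable_exp_inner_stdGaussian x₀).mul_const _
    refine (h1.const_mul B).mono' (by fun_prop) (.of_forall fun z => ?_)
    rw [norm_smul, Real.norm_eq_abs, abs_of_pos (Real.exp_pos _), mul_comm]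
    exact mul_le_mul_of_nonneg_right (hB z) (Real.exp_pos _).le
  · exact ((innerSL ℝ).continuous.comp_aestronglyMeasurable (Measurable.aestronglyMeasurable
      (by fun_prop)))
  · rw [innerSL_apply_norm]
    exact norm_exp_smul_smul_sub_le hB hx z
  · have h1 : HasFDerivAt (fun x : E => inner ℝ z x - ‖x‖ ^ 2 / 2) (innerSL ℝ (z - x)) x := by
      have ha : HasFDerivAt (fun x : E => (inner ℝ z x : ℝ)) (innerSL ℝ z) x :=
        (innerSL ℝ z).hasFDerivAt
      have hb := ((hasStrictFDerivAt_norm_sq x).hasFDerivAt).const_mul (1 / 2 : ℝ)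
      have := ha.sub hb
      refine (this.congr_fderiv ?_).congr_of_eventuallyEq (.of_forall fun y => ?_)
      · ext w; simp
      · simp; ring
    have h2 := h1.exp.smul_const (F z)
    refine h2.congr_fderiv ?_
    ext w
    simp
    ring

lemma continuous_gaussMoment_one {F : E → ℝ} (hF : Measurable F) {B : ℝ}
    (hB : ∀ x, |F x| ≤ B) : Continuous (gaussMoment 1 F) := by
  have hfun : gaussMoment 1 F = fun x => ∫ z, Real.exp (inner ℝ z x - ‖x‖ ^ 2 / 2)
      • (F z • (z - x)) ∂(stdGaussian E) := funext fun x => gaussMoment_one_eq F x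
  rw [hfun, continuous_iff_continuousAt]
  intro x₀
  refine continuousAt_of_dominated (bound := fun z => B * (‖z‖ ^ 1 * Real.exp ((‖x₀‖ + 1) * ‖z‖)
        + (‖x₀‖ + 1) * Real.exp ((‖x₀‖ + 1) * ‖z‖)))
    (.of_forall fun x => Measurable.aestronglyMeasurable (by fun_prop)) ?_
    (integrable_smoothing_bound B x₀) (.of_forall fun z => ?_)
  · filter_upwards [Metric.ball_mem_nhds x₀ one_pos] with x hx
    exact .of_forall fun z => norm_exp_smul_smul_sub_le hB hx z
  · exact Continuous.continuousAt (by fun_prop)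

lemma hasFDerivAt_gaussSmooth {σ : ℝ} (hσ : σ ≠ 0) {F : E → ℝ} (hF : Measurable F) {B : ℝ}
    (hB : ∀ x, |F x| ≤ B) (x : E) :
    HasFDerivAt (gaussSmooth σ F) (innerSL ℝ (σ⁻¹ • gaussMoment σ F x)) x := by
  have hfun : gaussSmooth σ F = (gaussSmooth 1 (fun z => F (σ • z))) ∘ fun x => σ⁻¹ • x :=
    funext fun x => gaussSmooth_eq_one σ hσ F x
  rw [hfun, gaussMoment_eq_one σ hσ]
  have h1 := hasFDerivAt_gaussSmooth_one (F := fun z => F (σ • z)) (by fun_prop)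
    (fun z => hB _) (σ⁻¹ • x)
  have h2 : HasFDerivAt (fun x : E => σ⁻¹ • x) (σ⁻¹ • ContinuousLinearMap.id ℝ E) x :=
    (hasFDerivAt_id x).const_smul _
  refine (h1.comp x h2).congr_fderiv ?_
  ext w
  simp

lemma fderiv_gaussSmooth {σ : ℝ} (hσ : σ ≠ 0) {F : E → ℝ} (hF : Measurable F) {B : ℝ}
    (hB : ∀ x, |F x| ≤ B) :
    fderiv ℝ (gaussSmooth σ F) = fun x => innerSL ℝ (σ⁻¹ • gaussMoment σ F x) :=
  funext fun x => (hasFDerivAt_gaussSmooth hσ hF hB x).fderiv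

lemma contDiff_gaussSmooth {σ : ℝ} (hσ : σ ≠ 0) {F : E → ℝ} (hF : Measurable F) {B : ℝ}
    (hB : ∀ x, |F x| ≤ B) : ContDiff ℝ 1 (gaussSmooth σ F) := by
  rw [contDiff_one_iff_fderiv]
  refine ⟨fun x => (hasFDerivAt_gaussSmooth hσ hF hB x).differentiableAt, ?_⟩
  rw [fderiv_gaussSmooth hσ hF hB]
  have : gaussMoment σ F = (gaussMoment 1 (fun z => F (σ • z))) ∘ fun x => σ⁻¹ • x :=
    funext fun x => gaussMoment_eq_one σ hσ F x
  rw [this]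
  exact (innerSL ℝ).continuous.comp (((continuous_gaussMoment_one (F := fun z => F (σ • z))
    (by fun_prop) (fun z => hB _)).comp (continuous_const_smul σ⁻¹)).const_smul σ⁻¹)

lemma norm_gaussMoment_le (σ : ℝ) {F : E → ℝ} {B : ℝ}
    (hB : ∀ x, |F x| ≤ B) (x : E) :
    ‖gaussMoment σ F x‖ ≤ B * ∫ z : E, ‖z‖ ^ 1 ∂(stdGaussian E) := by
  rw [gaussMoment, ← integral_const_mul]
  refine norm_integral_le_of_norm_le ((integrable_norm_pow_stdGaussian (E := E) 1).const_mul B)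
    (.of_forall fun z => ?_)
  rw [norm_smul, pow_one]
  exact mul_le_mul_of_nonneg_right (hB _) (norm_nonneg z)

end GaussSmooth

/-! ### Poincaré inequalities: the Gaussian case and stability under Gaussian convolution. -/

section Poincare

variable {E : Type*} [NormedAddCommGroup E] [InnerProductSpace ℝ E] [FiniteDimensional ℝ E]
  [MeasurableSpace E] [BorelSpace E]

/-- The Poincaré inequality with constant `C` on the class of bounded `C¹` functions with bounded
derivative. -/
def PoincareC1 (μ : Measure E) (C : ℝ) : Prop :=
  ∀ (k : E → ℝ) (B D : ℝ), ContDiff ℝ 1 k → (∀ x, |k x| ≤ B) → (∀ x, ‖fderiv ℝ k x‖ ≤ D) →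
    (∫ x, k x ^ 2 ∂μ) - (∫ x, k x ∂μ) ^ 2 ≤ C * ∫ x, ‖fderiv ℝ k x‖ ^ 2 ∂μ

lemma sq_intervalIntegral_le {a b : ℝ} (hab : a < b) {g : ℝ → ℝ} (hg : Continuous g) :
    (∫ t in a..b, g t) ^ 2 ≤ (b - a) * ∫ t in a..b, g t ^ 2 := by
  set I := ∫ t in a..b, g t
  have h0 : 0 ≤ ∫ t in a..b, ((b - a) * g t - I) ^ 2 :=
    intervalIntegral.integral_nonneg hab.le fun t _ => sq_nonneg _
  have h1 : ∫ t in a..b, ((b - a) * g t - I) ^ 2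
      = (b - a) ^ 2 * (∫ t in a..b, g t ^ 2) - (2 * (b - a) * I) * I + (b - a) * I ^ 2 := by
    have e : ∀ t, ((b - a) * g t - I) ^ 2
        = (b - a) ^ 2 * g t ^ 2 - (2 * (b - a) * I) * g t + I ^ 2 := fun t => by ring
    simp_rw [e]
    rw [intervalIntegral.integral_add, intervalIntegral.integral_sub,
      intervalIntegral.integral_const_mul, intervalIntegral.integral_const_mul,
      intervalIntegral.integral_const, smul_eq_mul]
    all_goals exact Continuous.intervalIntegrable (by fun_prop) _ _
  rw [h1] at h0
  have h2 : 0 ≤ (b - a) * ((b - a) * (∫ t in a..b, g t ^ 2) - I ^ 2) := by nlinarith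
  have := nonneg_of_mul_nonneg_right h2 (by linarith : 0 < b - a)
  linarith

lemma integrable_norm_sq_prod_stdGaussian :
    Integrable (fun p : E × E => 2 * ‖p.1‖ ^ 2 + 2 * ‖p.2‖ ^ 2)
      ((stdGaussian E).prod (stdGaussian E)) :=
  (((integrable_norm_pow_stdGaussian 2).comp_fst _).const_mul 2).add
    (((integrable_norm_pow_stdGaussian 2).comp_snd _).const_mul 2)

lemma norm_sq_rotation_le (θ : ℝ) (p : E × E) :
    ‖(ContinuousLinearMap.rotation θ p).2‖ ^ 2 ≤ 2 * ‖p.1‖ ^ 2 + 2 * ‖p.2‖ ^ 2 := by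
  have h : ‖(ContinuousLinearMap.rotation θ p).2‖ ≤ ‖p.1‖ + ‖p.2‖ := by
    change ‖-Real.sin θ • p.1 + Real.cos θ • p.2‖ ≤ _
    refine (norm_add_le _ _).trans ?_
    rw [norm_smul, norm_smul, norm_neg, Real.norm_eq_abs, Real.norm_eq_abs]
    have h1 := mul_le_mul_of_nonneg_right (Real.abs_sin_le_one θ) (norm_nonneg p.1)
    have h2 := mul_le_mul_of_nonneg_right (Real.abs_cos_le_one θ) (norm_nonneg p.2)
    linarith
  calc _ ≤ (‖p.1‖ + ‖p.2‖) ^ 2 := by gcongr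
    _ ≤ _ := by nlinarith [sq_nonneg (‖p.1‖ - ‖p.2‖)]

lemma integral_apply_sq_stdGaussian (L : E →L[ℝ] ℝ) :
    ∫ w, (L w) ^ 2 ∂(stdGaussian E) = ‖L‖ ^ 2 := by
  have hc : CompleteSpace E := FiniteDimensional.complete ℝ E
  have h := integral_inner_sq_stdGaussian ((InnerProductSpace.toDual ℝ E).symm L)
  rw [LinearIsometryEquiv.norm_map] at h
  rw [← h]
  refine integral_congr_ae (.of_forall fun w => ?_)
  simp only
  rw [real_inner_comm, InnerProductSpace.toDual_symm_apply]

/-- The Gaussian Poincaré inequality with the Maurey–Pisier constant `π² / 8`. -/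
lemma poincareC1_stdGaussian : PoincareC1 (stdGaussian E) (Real.pi ^ 2 / 8) := by
  intro k B D hk hB hD
  have hc : CompleteSpace E := FiniteDimensional.complete ℝ E
  have hD0 : 0 ≤ D := (norm_nonneg _).trans (hD 0)
  set γ := stdGaussian E
  have hkc : Continuous k := hk.continuous
  have hk' : Continuous (fderiv ℝ k) := hk.continuous_fderiv one_ne_zero
  have hki : Integrable k γ := integrable_of_abs_le hkc.measurable hB
  have hki2 : Integrable (fun x => k x ^ 2) γ :=
    integrable_of_abs_le (B := B ^ 2) (by fun_prop) fun x => by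
      rw [abs_pow]; exact pow_le_pow_left₀ (abs_nonneg _) (hB x) 2
  -- A rotation path from p.1 at θ = 0 to p.2 at θ = π/2, whose velocity is the second component of
  -- the rotated pair.
  let R : ℝ → E × E → E × E := fun θ p =>
    (Real.cos θ • p.1 + Real.sin θ • p.2, -Real.sin θ • p.1 + Real.cos θ • p.2)
  have hRr : ∀ θ p, R θ p = ContinuousLinearMap.rotation θ p := fun _ _ => rfl
  let Φ : ℝ → E × E → ℝ := fun θ p => fderiv ℝ k (R θ p).1 (R θ p).2
  have hRc : Continuous fun q : ℝ × E × E => R q.1 q.2 := by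
    simp only [R]; fun_prop
  have hΦc : Continuous fun q : ℝ × E × E => Φ q.1 q.2 := by
    have h1 : Continuous fun q : ℝ × E × E => fderiv ℝ k (R q.1 q.2).1 :=
      hk'.comp (continuous_fst.comp hRc)
    exact h1.clm_apply (continuous_snd.comp hRc)
  have hΦb : ∀ θ p, Φ θ p ^ 2 ≤ D ^ 2 * (2 * ‖p.1‖ ^ 2 + 2 * ‖p.2‖ ^ 2) := by
    intro θ p
    have h1 : |Φ θ p| ≤ D * ‖(R θ p).2‖ :=
      ((fderiv ℝ k (R θ p).1).le_opNorm _).trans (by gcongr; exact hD _)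
    calc Φ θ p ^ 2 = |Φ θ p| ^ 2 := (sq_abs _).symm
      _ ≤ (D * ‖(R θ p).2‖) ^ 2 := by gcongr
      _ = D ^ 2 * ‖(R θ p).2‖ ^ 2 := by ring
      _ ≤ _ := by gcongr; exact norm_sq_rotation_le θ p
  have hftc : ∀ p : E × E, k p.2 - k p.1 = ∫ θ in (0 : ℝ)..(Real.pi / 2), Φ θ p := by
    intro p
    have hd : ∀ θ : ℝ, HasDerivAt (fun θ => k (R θ p).1) (Φ θ p) θ := by
      intro θ
      have h1 : HasDerivAt (fun θ => (R θ p).1) ((R θ p).2) θ := by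
        have := ((Real.hasDerivAt_cos θ).smul_const p.1).add
          ((Real.hasDerivAt_sin θ).smul_const p.2)
        exact this
      exact ((hk.differentiable one_ne_zero _).hasFDerivAt).comp_hasDerivAt θ h1
    rw [intervalIntegral.integral_eq_sub_of_hasDerivAt (fun θ _ => hd θ)
      (Continuous.intervalIntegrable (hΦc.comp (by fun_prop : Continuous fun θ => (θ, p))) _ _)]
    simp [R]
  have hpi : 0 < Real.pi / 2 := by positivity
  have hbound : ∀ p : E × E, (k p.2 - k p.1) ^ 2
      ≤ Real.pi / 2 * ∫ θ in (0 : ℝ)..(Real.pi / 2), Φ θ p ^ 2 := by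
    intro p
    rw [hftc p]
    simpa using sq_intervalIntegral_le hpi
      (hΦc.comp (by fun_prop : Continuous fun θ : ℝ => (θ, p)))
  have hint : Integrable (fun q : ℝ × E × E => Φ q.1 q.2 ^ 2)
      ((volume.restrict (Set.Ioc 0 (Real.pi / 2))).prod (γ.prod γ)) := by
    refine ((integrable_norm_sq_prod_stdGaussian.const_mul (D ^ 2)).comp_snd _).mono'
      (hΦc.pow 2).aestronglyMeasurable (.of_forall fun q => ?_)
    rw [Real.norm_eq_abs, abs_of_nonneg (sq_nonneg _)]
    exact hΦb _ _
  -- The product Gaussian is rotation invariant, so every θ contributes as much as θ = 0. The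
  -- interval length π/2 enters once by Cauchy–Schwarz and once by integration; halving for the
  -- doubled variance yields π²/8.
  have hrot : ∀ θ, ∫ p, Φ θ p ^ 2 ∂(γ.prod γ) = ∫ x, ‖fderiv ℝ k x‖ ^ 2 ∂γ := by
    intro θ
    have hm := IsGaussian.map_rotation_eq_self (μ := γ) (by simp [γ]) θ
    have hcont : Continuous fun p : E × E => (fderiv ℝ k p.1 p.2) ^ 2 :=
      ((hk'.comp continuous_fst).clm_apply continuous_snd).pow 2
    have h1 : ∫ p, Φ θ p ^ 2 ∂(γ.prod γ) = ∫ p, (fderiv ℝ k p.1 p.2) ^ 2 ∂(γ.prod γ) := by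
      conv_rhs => rw [← hm]
      rw [integral_map (by fun_prop) hcont.aestronglyMeasurable]
      rfl
    rw [h1, integral_prod]
    · exact integral_congr_ae (.of_forall fun x => integral_apply_sq_stdGaussian (fderiv ℝ k x))
    · refine (integrable_norm_sq_prod_stdGaussian.const_mul (D ^ 2)).mono'
        hcont.aestronglyMeasurable (.of_forall fun p => ?_)
      rw [Real.norm_eq_abs, abs_of_nonneg (sq_nonneg _)]
      simpa [Φ, R] using hΦb 0 p
  have hswap : ∫ p, (∫ θ in (0 : ℝ)..(Real.pi / 2), Φ θ p ^ 2) ∂(γ.prod γ)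
      = Real.pi / 2 * ∫ x, ‖fderiv ℝ k x‖ ^ 2 ∂γ := by
    simp_rw [intervalIntegral.integral_of_le hpi.le]
    rw [← integral_integral_swap hint]
    simp_rw [hrot]
    simp [hpi.le]
  have hint2 : Integrable (fun p : E × E => ∫ θ in (0 : ℝ)..(Real.pi / 2), Φ θ p ^ 2)
      (γ.prod γ) := by
    simp_rw [intervalIntegral.integral_of_le hpi.le]
    exact hint.integral_prod_right
  have hvar : ∫ p : E × E, (k p.2 - k p.1) ^ 2 ∂(γ.prod γ)
      = 2 * ((∫ x, k x ^ 2 ∂γ) - (∫ x, k x ∂γ) ^ 2) := by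
    have e : ∀ p : E × E, (k p.2 - k p.1) ^ 2 = k p.2 ^ 2 + k p.1 ^ 2 - 2 * (k p.1 * k p.2) :=
      fun p => by ring
    simp_rw [e]
    rw [integral_sub, integral_add, integral_const_mul, integral_prod_mul (fun x => k x)
      (fun x => k x), integral_fun_snd (fun x => k x ^ 2), integral_fun_fst (fun x => k x ^ 2)]
    · simp; ring
    · exact hki2.comp_snd _
    · exact hki2.comp_fst _
    · exact (hki2.comp_snd _).add (hki2.comp_fst _)
    · exact (hki.mul_prod hki).const_mul 2
  have hfin := integral_mono_of_nonneg (μ := γ.prod γ) (.of_forall fun p => sq_nonneg _)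
    (hint2.const_mul (Real.pi / 2)) (.of_forall hbound)
  rw [hvar, integral_const_mul, hswap] at hfin
  nlinarith

/-- For C¹ functions the derivative falls on k itself, which keeps the bound D and lets Jensen
compare ‖∇Pk‖² with P‖∇k‖². -/
lemma hasFDerivAt_gaussSmooth_of_contDiff (σ : ℝ) {k : E → ℝ} {B D : ℝ} (hk : ContDiff ℝ 1 k)
    (hB : ∀ x, |k x| ≤ B) (hD : ∀ x, ‖fderiv ℝ k x‖ ≤ D) (x : E) :
    HasFDerivAt (gaussSmooth σ k) (∫ z, fderiv ℝ k (x + σ • z) ∂(stdGaussian E)) x := by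
  have hc : CompleteSpace E := FiniteDimensional.complete ℝ E
  have hkc := hk.continuous
  have hk' : Continuous (fderiv ℝ k) := hk.continuous_fderiv one_ne_zero
  refine hasFDerivAt_integral_of_dominated_of_fderiv_le (bound := fun _ => D)
    (F' := fun x z => fderiv ℝ k (x + σ • z)) Filter.univ_mem
    (.of_forall fun y => (Continuous.aestronglyMeasurable (by fun_prop)))
    (integrable_comp_add_smul_stdGaussian σ hkc.measurable hB x)
    (Continuous.aestronglyMeasurable (by fun_prop)) (.of_forall fun z y _ => hD _)
    (integrable_const _) (.of_forall fun z y _ => ?_)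
  have h1 : HasFDerivAt (fun y => y + σ • z) (ContinuousLinearMap.id ℝ E) y :=
    (hasFDerivAt_id y).add_const _
  exact ((hk.differentiable one_ne_zero _).hasFDerivAt).comp y h1

lemma norm_integral_sq_le {α G : Type*} [MeasurableSpace α] {μ : Measure α}
    [IsProbabilityMeasure μ] [NormedAddCommGroup G] [NormedSpace ℝ G] {F : α → G} {D : ℝ}
    (hF : AEStronglyMeasurable F μ) (hD : ∀ x, ‖F x‖ ≤ D) :
    ‖∫ x, F x ∂μ‖ ^ 2 ≤ ∫ x, ‖F x‖ ^ 2 ∂μ := by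
  have hi : Integrable (fun x => ‖F x‖) μ := (Integrable.of_bound hF D (.of_forall hD)).norm
  have hi2 : Integrable (fun x => ‖F x‖ ^ 2) μ :=
    Integrable.of_bound (hF.norm.pow 2) (D ^ 2) (.of_forall fun x => by
      rw [Real.norm_eq_abs, abs_of_nonneg (sq_nonneg _)]
      exact pow_le_pow_left₀ (norm_nonneg _) (hD x) 2)
  set I := ∫ x, ‖F x‖ ∂μ
  have h0 : 0 ≤ ∫ x, (‖F x‖ - I) ^ 2 ∂μ := integral_nonneg fun _ => sq_nonneg _
  have e : ∀ x, (‖F x‖ - I) ^ 2 = ‖F x‖ ^ 2 - 2 * I * ‖F x‖ + I ^ 2 := fun x => by ring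
  simp_rw [e] at h0
  have h3 : ∫ x, (‖F x‖ ^ 2 - 2 * I * ‖F x‖ + I ^ 2) ∂μ
      = (∫ x, ‖F x‖ ^ 2 ∂μ) - 2 * I * I + I ^ 2 := by
    rw [integral_add, integral_sub hi2 (hi.const_mul _), integral_const_mul]
    · simp [I]
    · exact hi2.sub (hi.const_mul _)
    · exact integrable_const _
  rw [h3] at h0
  have h1 : ‖∫ x, F x ∂μ‖ ≤ I := norm_integral_le_integral_norm _
  have h2 : ‖∫ x, F x ∂μ‖ ^ 2 ≤ I ^ 2 := by gcongr
  nlinarith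

/-- Law of total variance: the conditional variance given the μ-variable is bounded by the rescaled
Gaussian inequality, the variance of the conditional mean by that of μ together with ‖∇Pk‖² ≤
P‖∇k‖². -/
lemma PoincareC1.gaussConv {μ : Measure E} [IsProbabilityMeasure μ] {C : ℝ} (hC : 0 ≤ C)
    (h : PoincareC1 μ C) (σ : ℝ) :
    PoincareC1 (gaussConv σ μ) (C + σ ^ 2 * (Real.pi ^ 2 / 8)) := by
  intro k B D hk hB hD
  have hc : CompleteSpace E := FiniteDimensional.complete ℝ E
  have hkc := hk.continuous
  have hk' : Continuous (fderiv ℝ k) := hk.continuous_fderiv one_ne_zero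
  have hD0 : 0 ≤ D := (norm_nonneg _).trans (hD 0)
  have hB2 : ∀ x, |k x ^ 2| ≤ B ^ 2 := fun x => by
    rw [abs_pow]; exact pow_le_pow_left₀ (abs_nonneg _) (hB x) 2
  have hD2 : ∀ x, |‖fderiv ℝ k x‖ ^ 2| ≤ D ^ 2 := fun x => by
    rw [abs_pow, abs_norm]; exact pow_le_pow_left₀ (norm_nonneg _) (hD x) 2
  have hkm2 : Measurable fun x => k x ^ 2 := by fun_prop
  have hdm2 : Measurable fun x => ‖fderiv ℝ k x‖ ^ 2 := (hk'.norm.pow 2).measurable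
  rw [integral_gaussConv σ μ hkm2 hB2, integral_gaussConv σ μ hkc.measurable hB,
    integral_gaussConv σ μ hdm2 hD2]
  have hfd := hasFDerivAt_gaussSmooth_of_contDiff σ hk hB hD
  have hfd' : fderiv ℝ (gaussSmooth σ k) = fun x => ∫ z, fderiv ℝ k (x + σ • z) ∂(stdGaussian E) :=
    funext fun x => (hfd x).fderiv
  have hcd : ContDiff ℝ 1 (gaussSmooth σ k) := by
    rw [contDiff_one_iff_fderiv, hfd']
    refine ⟨fun x => (hfd x).differentiableAt, ?_⟩
    exact continuous_of_dominated (bound := fun _ => D)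
      (fun x => Continuous.aestronglyMeasurable (by fun_prop))
      (fun x => .of_forall fun z => hD _) (integrable_const _) (.of_forall fun z => by fun_prop)
  have hfdn : ∀ x, ‖fderiv ℝ (gaussSmooth σ k) x‖ ^ 2
      ≤ gaussSmooth σ (fun y => ‖fderiv ℝ k y‖ ^ 2) x := by
    intro x
    rw [hfd']
    exact norm_integral_sq_le (Continuous.aestronglyMeasurable (by fun_prop)) fun z => hD _
  have hfdD : ∀ x, ‖fderiv ℝ (gaussSmooth σ k) x‖ ≤ D := by
    intro x
    rw [hfd']
    simpa using norm_integral_le_of_norm_le_const (μ := stdGaussian E) (C := D)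
      (.of_forall fun z => hD (x + σ • z))
  have h1 := h (gaussSmooth σ k) B D hcd (abs_gaussSmooth_le σ hB) hfdD
  have hloc : ∀ x, gaussSmooth σ (fun y => k y ^ 2) x - gaussSmooth σ k x ^ 2
      ≤ σ ^ 2 * (Real.pi ^ 2 / 8) * gaussSmooth σ (fun y => ‖fderiv ℝ k y‖ ^ 2) x := by
    intro x
    have hff : ∀ z, fderiv ℝ (fun z => k (x + σ • z)) z = σ • fderiv ℝ k (x + σ • z) := by
      intro z
      have h1 : HasFDerivAt (fun z : E => x + σ • z) (σ • ContinuousLinearMap.id ℝ E) z :=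
        ((hasFDerivAt_id z).const_smul σ).const_add x
      have := ((hk.differentiable one_ne_zero (x + σ • z)).hasFDerivAt).comp z h1
      rw [HasFDerivAt.fderiv (f := fun z => k (x + σ • z)) this]
      ext w; simp
    have := poincareC1_stdGaussian (E := E) (fun z => k (x + σ • z)) B (|σ| * D)
      (hk.comp (by fun_prop)) (fun z => hB _) (fun z => by
        rw [hff, norm_smul, Real.norm_eq_abs]; gcongr; exact hD _)
    simp_rw [hff, norm_smul, mul_pow, Real.norm_eq_abs, sq_abs] at this
    rw [integral_const_mul] at this
    simp only [gaussSmooth]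
    linarith
  have mS : ∀ {F : E → ℝ} {b : ℝ}, Measurable F → (∀ x, |F x| ≤ b) →
      Integrable (gaussSmooth σ F) μ := fun hF hb =>
    integrable_of_abs_le (measurable_gaussSmooth σ hF) (abs_gaussSmooth_le σ hb)
  have hi2 : Integrable (fun x => gaussSmooth σ k x ^ 2) μ :=
    integrable_of_abs_le (B := B ^ 2) ((measurable_gaussSmooth σ hkc.measurable).pow_const 2)
      fun x => by rw [abs_pow]; exact pow_le_pow_left₀ (abs_nonneg _) (abs_gaussSmooth_le σ hB x) 2
  have h2 := integral_mono ((mS hkm2 hB2).sub hi2) ((mS hdm2 hD2).const_mul _) hloc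
  rw [integral_sub' (mS hkm2 hB2) hi2, integral_const_mul] at h2
  have h3 := integral_mono_of_nonneg (.of_forall fun x => sq_nonneg _) (mS hdm2 hD2)
    (.of_forall hfdn)
  have h4 := mul_le_mul_of_nonneg_left h3 hC
  linarith

end Poincare

/-! ### From smooth to C¹ test functions. -/

section Mollify

open scoped Convolution

variable {E : Type*} [NormedAddCommGroup E] [InnerProductSpace ℝ E] [FiniteDimensional ℝ E]
  [MeasurableSpace E] [BorelSpace E]

lemma norm_bump_convolution_le {G : Type*} [NormedAddCommGroup G] [NormedSpace ℝ G]
    (φ : ContDiffBump (0 : E)) {g : E → G} {D : ℝ} (hD : ∀ x, ‖g x‖ ≤ D) (x : E) :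
    ‖(φ.normed volume ⋆[ContinuousLinearMap.lsmul ℝ ℝ, volume] g) x‖ ≤ D := by
  rw [convolution_def]
  have hi : Integrable (fun t => φ.normed volume t * D) :=
    (φ.integrable_normed).mul_const D
  refine (norm_integral_le_of_norm_le hi (.of_forall fun t => ?_)).trans ?_
  · simp only [ContinuousLinearMap.lsmul_apply, norm_smul]
    rw [Real.norm_eq_abs, abs_of_nonneg (φ.nonneg_normed t)]
    exact mul_le_mul_of_nonneg_left (hD _) (φ.nonneg_normed t)
  · rw [integral_mul_const, φ.integral_normed, one_mul]

/-- With the derivative on k rather than on the bump, the derivatives of the mollifications stay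
bounded by D and converge pointwise. -/
lemma hasFDerivAt_bump_convolution (φ : ContDiffBump (0 : E)) {k : E → ℝ} {B D : ℝ}
    (hk : ContDiff ℝ 1 k) (hB : ∀ x, |k x| ≤ B) (hD : ∀ x, ‖fderiv ℝ k x‖ ≤ D) (x : E) :
    HasFDerivAt (φ.normed volume ⋆[ContinuousLinearMap.lsmul ℝ ℝ, volume] k)
      ((φ.normed volume ⋆[ContinuousLinearMap.lsmul ℝ ℝ, volume] (fderiv ℝ k)) x) x := by
  have hk' : Continuous (fderiv ℝ k) := hk.continuous_fderiv one_ne_zero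
  have hkc := hk.continuous
  have hφ : Continuous (φ.normed volume) := φ.continuous_normed
  have hfun : (φ.normed volume ⋆[ContinuousLinearMap.lsmul ℝ ℝ, volume] k)
      = fun x => ∫ t, φ.normed volume t • k (x - t) := by
    ext x; rw [convolution_def]; simp
  have hfun' : (φ.normed volume ⋆[ContinuousLinearMap.lsmul ℝ ℝ, volume] (fderiv ℝ k)) x
      = ∫ t, φ.normed volume t • fderiv ℝ k (x - t) := by
    rw [convolution_def]; simp
  rw [hfun, hfun']
  refine hasFDerivAt_integral_of_dominated_of_fderiv_le
    (bound := fun t => φ.normed volume t * D)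
    (F' := fun x t => φ.normed volume t • fderiv ℝ k (x - t)) Filter.univ_mem
    (.of_forall fun y => (Continuous.aestronglyMeasurable (by fun_prop))) ?_
    (Continuous.aestronglyMeasurable (by fun_prop)) (.of_forall fun t y _ => ?_)
    ((φ.integrable_normed).mul_const D) (.of_forall fun t y _ => ?_)
  · refine ((φ.integrable_normed (μ := volume)).mul_const B).mono'
      (Continuous.aestronglyMeasurable (by fun_prop)) (.of_forall fun t => ?_)
    rw [norm_smul, Real.norm_eq_abs, abs_of_nonneg (φ.nonneg_normed t)]
    exact mul_le_mul_of_nonneg_left (hB _) (φ.nonneg_normed t)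
  · rw [norm_smul, Real.norm_eq_abs, abs_of_nonneg (φ.nonneg_normed t)]
    exact mul_le_mul_of_nonneg_left (hD _) (φ.nonneg_normed t)
  · have h1 : HasFDerivAt (fun y : E => y - t) (ContinuousLinearMap.id ℝ E) y :=
      (hasFDerivAt_id y).sub_const _
    have h2 : HasFDerivAt (fun y : E => k (y - t)) (fderiv ℝ k (y - t)) y :=
      ((hk.differentiable one_ne_zero (y - t)).hasFDerivAt).comp y h1
    exact h2.const_smul (φ.normed volume t)

/-- A Poincaré inequality for smooth functions extends to bounded `C¹` functions with bounded
derivative, by mollification. -/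
lemma SatisfiesPoincare.poincareC1 {n : ℕ} {μ : Measure (EuclideanSpace ℝ (Fin n))}
    [IsProbabilityMeasure μ] {β : ℝ} (h : SatisfiesPoincare μ β) : PoincareC1 μ (1 / β) := by
  intro k B D hk hB hD
  have hk' : Continuous (fderiv ℝ k) := hk.continuous_fderiv one_ne_zero
  let φ : ℕ → ContDiffBump (0 : EuclideanSpace ℝ (Fin n)) := fun m =>
    ⟨1 / (m + 2), 1 / (m + 1), by positivity, by gcongr; linarith⟩
  have hφ : Tendsto (fun m => (φ m).rOut) atTop (𝓝 0) := tendsto_one_div_add_atTop_nhds_zero_nat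
  let km : ℕ → EuclideanSpace ℝ (Fin n) → ℝ := fun m =>
    (φ m).normed volume ⋆[ContinuousLinearMap.lsmul ℝ ℝ, volume] k
  let dm : ℕ → EuclideanSpace ℝ (Fin n) → (EuclideanSpace ℝ (Fin n) →L[ℝ] ℝ) := fun m =>
    (φ m).normed volume ⋆[ContinuousLinearMap.lsmul ℝ ℝ, volume] (fderiv ℝ k)
  have hd : ∀ m, fderiv ℝ (km m) = dm m := fun m =>
    funext fun x => (hasFDerivAt_bump_convolution (φ m) hk hB hD x).fderiv
  have hsm : ∀ m, ContDiff ℝ ∞ (km m) := fun m =>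
    (φ m).hasCompactSupport_normed.contDiff_convolution_left _ (φ m).contDiff_normed
      hk.continuous.locallyIntegrable
  have hkb : ∀ m x, ‖km m x‖ ≤ B := fun m x => norm_bump_convolution_le (φ m) hB x
  have hdb : ∀ m x, ‖dm m x‖ ≤ D := fun m x => norm_bump_convolution_le (φ m) hD x
  have hkl : ∀ x, Tendsto (fun m => km m x) atTop (𝓝 (k x)) := fun x =>
    ContDiffBump.convolution_tendsto_right_of_continuous hφ hk.continuous x
  have hdl : ∀ x, Tendsto (fun m => dm m x) atTop (𝓝 (fderiv ℝ k x)) := fun x =>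
    ContDiffBump.convolution_tendsto_right_of_continuous hφ hk' x
  have hkc : ∀ m, Continuous (km m) := fun m => (hsm m).continuous
  have hdc : ∀ m, Continuous (dm m) := fun m => by
    rw [← hd]; exact (hsm m).continuous_fderiv (by simp)
  have hgn : ∀ m x, ‖∇ (km m) x‖ = ‖dm m x‖ := fun m x => by
    rw [gradient, LinearIsometryEquiv.norm_map, hd]
  have hineq : ∀ m, (∫ x, km m x ^ 2 ∂μ) - (∫ x, km m x ∂μ) ^ 2
      ≤ 1 / β * ∫ x, ‖dm m x‖ ^ 2 ∂μ := by
    intro m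
    have := h (km m) (hsm m) (MemLp.of_bound (hkc m).aestronglyMeasurable B (.of_forall (hkb m)))
      (MemLp.of_bound (Continuous.aestronglyMeasurable (by
        have : ∇ (km m) = fun x => (InnerProductSpace.toDual ℝ _).symm (dm m x) := by
          funext x; rw [gradient, hd]
        rw [this]
        exact (LinearIsometryEquiv.continuous _).comp (hdc m))) D
        (.of_forall fun x => (hgn m x).trans_le (hdb m x)))
    simpa only [hgn] using this
  have l1 : Tendsto (fun m => ∫ x, km m x ∂μ) atTop (𝓝 (∫ x, k x ∂μ)) :=
    tendsto_integral_of_dominated_convergence (fun _ => B)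
      (fun m => (hkc m).aestronglyMeasurable) (integrable_const _)
      (fun m => .of_forall (hkb m)) (.of_forall hkl)
  have l2 : Tendsto (fun m => ∫ x, km m x ^ 2 ∂μ) atTop (𝓝 (∫ x, k x ^ 2 ∂μ)) :=
    tendsto_integral_of_dominated_convergence (fun _ => B ^ 2)
      (fun m => ((hkc m).pow 2).aestronglyMeasurable) (integrable_const _)
      (fun m => .of_forall fun x => by
        rw [norm_pow]; exact pow_le_pow_left₀ (norm_nonneg _) (hkb m x) 2)
      (.of_forall fun x => (hkl x).pow 2)
  have l3 : Tendsto (fun m => ∫ x, ‖dm m x‖ ^ 2 ∂μ) atTop (𝓝 (∫ x, ‖fderiv ℝ k x‖ ^ 2 ∂μ)) :=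
    tendsto_integral_of_dominated_convergence (fun _ => D ^ 2)
      (fun m => ((hdc m).norm.pow 2).aestronglyMeasurable) (integrable_const _)
      (fun m => .of_forall fun x => by
        rw [norm_pow, norm_norm]; exact pow_le_pow_left₀ (norm_nonneg _) (hdb m x) 2)
      (.of_forall fun x => ((hdl x).norm).pow 2)
  exact le_of_tendsto_of_tendsto' (l2.sub (l1.pow 2)) (l3.const_mul _) hineq

end Mollify

/-! ### Pointwise inequalities for powers and their Gaussian averages. -/

section LocalInequalities

/-- After expansion this is the weighted AM–GM bound r·a·b^(r-1) ≤ (2-r)a^r + 2(r-1)(ab)^(r/2),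
whose weights are nonnegative because 1 < r ≤ 2. -/
lemma bregman_rpow_ge {r a b : ℝ} (hr : 1 < r) (hr2 : r ≤ 2) (ha : 0 < a) (hb : 0 < b) :
    (r - 1) * (a ^ (r / 2) - b ^ (r / 2)) ^ 2 ≤ a ^ r - b ^ r - r * b ^ (r - 1) * (a - b) := by
  have e1 : ∀ {c : ℝ}, 0 < c → (c ^ (r / 2)) ^ 2 = c ^ r := fun {c} hc => by
    rw [← Real.rpow_natCast, ← Real.rpow_mul hc.le]; norm_num
  have e2 : b ^ (r - 1) * b = b ^ r := by
    rw [← Real.rpow_add_one hb.ne']; norm_num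
  have key := Real.geom_mean_le_arith_mean2_weighted (w₁ := (2 - r) / r) (w₂ := 2 * (r - 1) / r)
    (p₁ := a ^ r) (p₂ := a ^ (r / 2) * b ^ (r / 2)) (div_nonneg (by linarith) (by linarith))
    (div_nonneg (by linarith) (by linarith)) (by positivity) (by positivity)
    (by field_simp; ring)
  have e3 : (a ^ r) ^ ((2 - r) / r) * (a ^ (r / 2) * b ^ (r / 2)) ^ (2 * (r - 1) / r)
      = a * b ^ (r - 1) := by
    rw [Real.mul_rpow (by positivity) (by positivity), ← Real.rpow_mul ha.le,
      ← Real.rpow_mul ha.le, ← Real.rpow_mul hb.le, ← mul_assoc, ← Real.rpow_add ha]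
    have h1 : r * ((2 - r) / r) + r / 2 * (2 * (r - 1) / r) = 1 := by field_simp; ring
    have h2 : r / 2 * (2 * (r - 1) / r) = r - 1 := by field_simp
    rw [h1, h2, Real.rpow_one]
  rw [e3] at key
  have hr0 : 0 < r := by linarith
  have key2 : r * (a * b ^ (r - 1))
      ≤ (2 - r) * a ^ r + 2 * (r - 1) * (a ^ (r / 2) * b ^ (r / 2)) := by
    calc r * (a * b ^ (r - 1)) ≤ r * ((2 - r) / r * a ^ r
          + 2 * (r - 1) / r * (a ^ (r / 2) * b ^ (r / 2))) := by gcongr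
      _ = _ := by field_simp
  have h3 : (a ^ (r / 2) - b ^ (r / 2)) ^ 2
      = a ^ r - 2 * (a ^ (r / 2) * b ^ (r / 2)) + b ^ r := by
    rw [← e1 ha, ← e1 hb]; ring
  rw [h3]
  have h4 : r * b ^ (r - 1) * (a - b) = r * (a * b ^ (r - 1)) - r * b ^ r := by
    rw [← e2]; ring
  rw [h4]
  nlinarith

/-- Young's inequality for e^y and a, with e^y ≥ 1 + y and r/p = r - 1. For y affine in a Gaussian
variable the exponential term integrates explicitly. -/
lemma rpow_ge_of_holderConjugate {p r a y : ℝ} (hpr : p.HolderConjugate r) (ha : 0 ≤ a) :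
    r * (a * (1 + y)) - (r - 1) * Real.exp (p * y) ≤ a ^ r := by
  have h1 := Real.young_inequality_of_nonneg (Real.exp_pos y).le ha hpr
  have hr : 0 < r := hpr.symm.pos
  have hp : 0 < p := hpr.pos
  rw [← Real.exp_mul] at h1
  have h2 : 1 + y ≤ Real.exp y := by linarith [Real.add_one_le_exp y]
  have h3 : a * (1 + y) ≤ Real.exp y * a := by nlinarith
  have h4 : r * (a * (1 + y)) ≤ r * (Real.exp (y * p) / p + a ^ r / r) := by
    gcongr; linarith
  have h5 : r * (Real.exp (y * p) / p + a ^ r / r) = r / p * Real.exp (p * y) + a ^ r := by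
    rw [mul_comm y p]; field_simp
  have h6 : r / p = r - 1 := by
    have := hpr.symm.sub_one_mul_conj
    field_simp; linarith
  rw [h5, h6] at h4
  linarith

variable {E : Type*} [NormedAddCommGroup E] [InnerProductSpace ℝ E] [FiniteDimensional ℝ E]
  [MeasurableSpace E] [BorelSpace E]

lemma integrable_mul_inner_stdGaussian {F : E → ℝ} (hF : Measurable F) {B : ℝ}
    (hB : ∀ x, |F x| ≤ B) (v : E) :
    Integrable (fun z => F z * inner ℝ z v) (stdGaussian E) := by
  refine ((integrable_norm_pow_stdGaussian (E := E) 1).mul_const (B * ‖v‖)).mono' (by fun_prop)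
    (.of_forall fun z => ?_)
  rw [norm_mul, Real.norm_eq_abs, Real.norm_eq_abs, pow_one]
  calc |F z| * |(inner ℝ z v : ℝ)| ≤ B * (‖z‖ * ‖v‖) := by
        gcongr
        · exact (abs_nonneg _).trans (hB 0)
        · exact hB z
        · exact abs_real_inner_le_norm z v
    _ = _ := by ring

/-- Bessel's inequality for the linear functions of a Gaussian vector. -/
lemma norm_gaussMoment_sq_le (σ : ℝ) {G : E → ℝ} (hG : Measurable G) {B : ℝ}
    (hB : ∀ x, |G x| ≤ B) (x : E) (c : ℝ) :
    ‖gaussMoment σ G x‖ ^ 2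
      ≤ gaussSmooth σ (fun y => G y ^ 2) x - 2 * c * gaussSmooth σ G x + c ^ 2 := by
  set m := gaussMoment σ G x with hm
  have hB2 : ∀ x, |G x ^ 2| ≤ B ^ 2 := fun x => by
    rw [abs_pow]; exact pow_le_pow_left₀ (abs_nonneg _) (hB x) 2
  have i1 := integrable_comp_add_smul_stdGaussian σ (hG.pow_const 2) hB2 x
  have i2 := integrable_comp_add_smul_stdGaussian σ hG hB x
  have i3 : Integrable (fun z => G (x + σ • z) * inner ℝ z m) (stdGaussian E) :=
    integrable_mul_inner_stdGaussian (F := fun z => G (x + σ • z)) (by fun_prop) (fun z => hB _) m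
  have i4 := integrable_inner_stdGaussian m
  have i5 := integrable_inner_sq_stdGaussian m
  have h0 : 0 ≤ ∫ z, (G (x + σ • z) - c - inner ℝ z m) ^ 2 ∂(stdGaussian E) :=
    integral_nonneg fun _ => sq_nonneg _
  have e : ∀ z, (G (x + σ • z) - c - inner ℝ z m) ^ 2
      = G (x + σ • z) ^ 2 - 2 * c * G (x + σ • z) + c ^ 2 - 2 * (G (x + σ • z) * inner ℝ z m)
        + 2 * c * inner ℝ z m + (inner ℝ z m : ℝ) ^ 2 := fun z => by ring
  have e2 : ∫ z, (G (x + σ • z) - c - inner ℝ z m) ^ 2 ∂(stdGaussian E)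
      = gaussSmooth σ (fun y => G y ^ 2) x - 2 * c * gaussSmooth σ G x + c ^ 2
        - 2 * ‖m‖ ^ 2 + 2 * c * 0 + ‖m‖ ^ 2 := by
    simp_rw [e]
    have h3 := inner_gaussMoment σ hG hB x m
    rw [← hm, real_inner_self_eq_norm_sq] at h3
    have j1 : Integrable (fun z => G (x + σ • z) ^ 2 - 2 * c * G (x + σ • z)) (stdGaussian E) :=
      i1.sub (i2.const_mul _)
    have j2 : Integrable (fun z => G (x + σ • z) ^ 2 - 2 * c * G (x + σ • z) + c ^ 2)
      (stdGaussian E) := j1.add (integrable_const (c ^ 2))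
    have j3 : Integrable (fun z => G (x + σ • z) ^ 2 - 2 * c * G (x + σ • z) + c ^ 2
      - 2 * (G (x + σ • z) * inner ℝ z m)) (stdGaussian E) := j2.sub (i3.const_mul 2)
    have j4 : Integrable (fun z => G (x + σ • z) ^ 2 - 2 * c * G (x + σ • z) + c ^ 2
      - 2 * (G (x + σ • z) * inner ℝ z m) + 2 * c * inner ℝ z m) (stdGaussian E) :=
      j3.add (i4.const_mul (2 * c))
    rw [integral_add j4 i5, integral_inner_sq_stdGaussian]
    rw [integral_add j3 (i4.const_mul (2 * c)), integral_const_mul, integral_inner_stdGaussian]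
    rw [integral_sub j2 (i3.const_mul 2), integral_const_mul, ← h3]
    rw [integral_add j1 (integrable_const (c ^ 2)), integral_sub i1 (i2.const_mul _),
      integral_const_mul]
    simp [gaussSmooth]
  rw [e2] at h0
  linarith

/-- Average `bregman_rpow_ge` with a = g(x + σz) and b = Pg(x): the linear term has mean zero. -/
lemma gaussSmooth_rpow_sub_ge (σ : ℝ) {g : E → ℝ} (hg : Measurable g) {c₁ c₂ : ℝ} (hc₁ : 0 < c₁)
    (h₁ : ∀ x, c₁ ≤ g x) (h₂ : ∀ x, g x ≤ c₂) {r : ℝ} (hr : 1 < r) (hr2 : r ≤ 2) (x : E) :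
    (r - 1) * (gaussSmooth σ (fun y => g y ^ r) x
        - 2 * gaussSmooth σ g x ^ (r / 2) * gaussSmooth σ (fun y => g y ^ (r / 2)) x
        + gaussSmooth σ g x ^ r)
      ≤ gaussSmooth σ (fun y => g y ^ r) x - gaussSmooth σ g x ^ r := by
  have hgp : ∀ x, 0 < g x := fun x => hc₁.trans_le (h₁ x)
  have hb : ∀ x, |g x| ≤ c₂ := fun x => by rw [abs_of_pos (hgp x)]; exact h₂ x
  have hbr : ∀ s : ℝ, 0 ≤ s → ∀ x, |g x ^ s| ≤ c₂ ^ s := fun s hs x => by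
    rw [abs_of_pos (Real.rpow_pos_of_pos (hgp x) s)]
    exact Real.rpow_le_rpow (hgp x).le (h₂ x) hs
  set u := gaussSmooth σ g x with hu
  have hup : 0 < u := hc₁.trans_le (le_gaussSmooth σ hg hb h₁ x)
  have i1 := integrable_comp_add_smul_stdGaussian σ hg hb x
  have i2 := integrable_comp_add_smul_stdGaussian σ (hg.pow_const r) (hbr r (by linarith)) x
  have i3 := integrable_comp_add_smul_stdGaussian σ (hg.pow_const (r / 2))
    (hbr (r / 2) (by linarith)) x
  have e1 : ∀ {c : ℝ}, 0 < c → (c ^ (r / 2)) ^ 2 = c ^ r := fun {c} hc => by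
    rw [← Real.rpow_natCast, ← Real.rpow_mul hc.le]; norm_num
  have key : ∀ z, (r - 1) * (g (x + σ • z) ^ r - 2 * u ^ (r / 2) * g (x + σ • z) ^ (r / 2) + u ^ r)
      ≤ g (x + σ • z) ^ r - u ^ r - r * u ^ (r - 1) * (g (x + σ • z) - u) := by
    intro z
    have := bregman_rpow_ge hr hr2 (hgp (x + σ • z)) hup
    rw [← e1 (hgp (x + σ • z)), ← e1 hup] at this ⊢
    linarith
  have jl : Integrable (fun z => g (x + σ • z) ^ r - 2 * u ^ (r / 2) * g (x + σ • z) ^ (r / 2))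
      (stdGaussian E) := i2.sub (i3.const_mul _)
  have jr : Integrable (fun z => g (x + σ • z) ^ r - u ^ r) (stdGaussian E) :=
    i2.sub (integrable_const _)
  have jr2 : Integrable (fun z => g (x + σ • z) - u) (stdGaussian E) :=
    i1.sub (integrable_const _)
  have hm := integral_mono ((jl.add (integrable_const (u ^ r))).const_mul (r - 1))
    (jr.sub (jr2.const_mul (r * u ^ (r - 1)))) key
  simp only [Pi.add_apply, Pi.sub_apply] at hm
  rw [integral_const_mul, integral_add jl (integrable_const _), integral_sub i2 (i3.const_mul _),
    integral_const_mul, integral_sub jr (jr2.const_mul _), integral_const_mul,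
    integral_sub i2 (integrable_const _), integral_sub i1 (integrable_const _)] at hm
  simp only [integral_const, probReal_univ, one_smul] at hm
  have hu' : ∫ z, g (x + σ • z) ∂(stdGaussian E) = u := rfl
  rw [hu', sub_self, mul_zero, sub_zero] at hm
  exact hm

/-- A reverse local inequality for the Gaussian smoothing of a power. -/
lemma gaussSmooth_rpow_ge (σ : ℝ) {g : E → ℝ} (hg : Measurable g) {c₁ c₂ : ℝ} (hc₁ : 0 < c₁)
    (h₁ : ∀ x, c₁ ≤ g x) (h₂ : ∀ x, g x ≤ c₂) {p r : ℝ} (hpr : p.HolderConjugate r) (x : E) :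
    gaussSmooth σ g x ^ r
        + (r - 1) / 2 * (gaussSmooth σ g x ^ (r - 2) * ‖gaussMoment σ g x‖ ^ 2)
      ≤ gaussSmooth σ (fun y => g y ^ r) x := by
  have hr : 1 < r := hpr.symm.lt
  have hp : 0 < p := hpr.pos
  have hgp : ∀ x, 0 < g x := fun x => hc₁.trans_le (h₁ x)
  have hb : ∀ x, |g x| ≤ c₂ := fun x => by rw [abs_of_pos (hgp x)]; exact h₂ x
  have hbr : ∀ x, |g x ^ r| ≤ c₂ ^ r := fun x => by
    rw [abs_of_pos (Real.rpow_pos_of_pos (hgp x) r)]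
    exact Real.rpow_le_rpow (hgp x).le (h₂ x) (by linarith)
  set u := gaussSmooth σ g x with hu
  set m := gaussMoment σ g x with hmdef
  have hup : 0 < u := hc₁.trans_le (le_gaussSmooth σ hg hb h₁ x)
  -- The exponent is y = ⟨z, l⟩ - q. The constant q normalises E[e^(py)] to 1, and this l maximises
  -- the resulting lower bound ⟨l, m⟩ - u·p‖l‖²/2.
  set l : E := (p * u)⁻¹ • m with hl
  set q : ℝ := p * ‖l‖ ^ 2 / 2 with hq
  have i1 := integrable_comp_add_smul_stdGaussian σ hg hb x
  have i2 := integrable_comp_add_smul_stdGaussian σ (hg.pow_const r) hbr x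
  have i3 : Integrable (fun z => g (x + σ • z) * inner ℝ z l) (stdGaussian E) :=
    integrable_mul_inner_stdGaussian (F := fun z => g (x + σ • z)) (by fun_prop) (fun z => hb _) l
  have i4 := integrable_exp_inner_stdGaussian (p • l)
  have key : ∀ z, r * u⁻¹ * ((1 - q) * g (x + σ • z) + g (x + σ • z) * inner ℝ z l)
      - (r - 1) * Real.exp (-(p * q)) * Real.exp (inner ℝ z (p • l))
      ≤ (u ^ r)⁻¹ * g (x + σ • z) ^ r := by
    intro z
    have h := rpow_ge_of_holderConjugate (y := inner ℝ z l - q) hpr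
      (div_pos (hgp (x + σ • z)) hup).le
    rw [Real.div_rpow (hgp _).le hup.le] at h
    have e1 : Real.exp (p * (inner ℝ z l - q))
        = Real.exp (-(p * q)) * Real.exp (inner ℝ z (p • l)) := by
      rw [← Real.exp_add, real_inner_smul_right z l p]; congr 1; ring
    rw [e1] at h
    calc _ = r * (g (x + σ • z) / u * (1 + (inner ℝ z l - q)))
          - (r - 1) * (Real.exp (-(p * q)) * Real.exp (inner ℝ z (p • l))) := by
            field_simp; ring
      _ ≤ _ := h
      _ = _ := by rw [div_eq_inv_mul]
  have j1 : Integrable (fun z => (1 - q) * g (x + σ • z) + g (x + σ • z) * inner ℝ z l)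
      (stdGaussian E) := (i1.const_mul _).add i3
  have hm := integral_mono ((j1.const_mul (r * u⁻¹)).sub
    (i4.const_mul ((r - 1) * Real.exp (-(p * q))))) (i2.const_mul (u ^ r)⁻¹) key
  simp only [Pi.sub_apply] at hm
  rw [integral_sub (j1.const_mul _) (i4.const_mul _), integral_const_mul, integral_const_mul,
    integral_const_mul, integral_add (i1.const_mul _) i3, integral_const_mul,
    integral_exp_inner_stdGaussian, ← inner_gaussMoment σ hg hb x l, ← hmdef] at hm
  have hu' : ∫ z, g (x + σ • z) ∂(stdGaussian E) = u := rfl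
  have hv : ∫ z, g (x + σ • z) ^ r ∂(stdGaussian E) = gaussSmooth σ (fun y => g y ^ r) x := rfl
  rw [hu', hv] at hm
  have n1 : ‖p • l‖ ^ 2 / 2 = p * q := by
    rw [norm_smul, mul_pow, Real.norm_eq_abs, sq_abs, hq]; ring
  have n2 : ‖l‖ ^ 2 = (p * u)⁻¹ ^ 2 * ‖m‖ ^ 2 := by
    rw [hl, norm_smul, mul_pow, Real.norm_eq_abs, sq_abs]
  have n3 : (inner ℝ l m : ℝ) = (p * u)⁻¹ * ‖m‖ ^ 2 := by
    rw [hl, inner_smul_left, real_inner_self_eq_norm_sq]; simp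
  rw [n1, mul_assoc (r - 1), ← Real.exp_add, neg_add_cancel, Real.exp_zero, mul_one, n3] at hm
  have hrp : r / p = r - 1 := by
    have := hpr.symm.sub_one_mul_conj
    field_simp; linarith
  have lhs : r * u⁻¹ * ((1 - q) * u + (p * u)⁻¹ * ‖m‖ ^ 2) - (r - 1)
      = 1 + r / p / 2 * (‖m‖ ^ 2 / u ^ 2) := by
    rw [hq, n2]; field_simp; ring
  have hur : 0 < u ^ r := Real.rpow_pos_of_pos hup r
  have e2 : u ^ (r - 2) = u ^ r / u ^ 2 := by
    rw [Real.rpow_sub hup]; norm_num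
  rw [e2]
  rw [lhs, hrp] at hm
  calc _ = u ^ r * (1 + (r - 1) / 2 * (‖m‖ ^ 2 / u ^ 2)) := by ring
    _ ≤ u ^ r * ((u ^ r)⁻¹ * gaussSmooth σ (fun y => g y ^ r) x) := by gcongr
    _ = _ := by field_simp

end LocalInequalities

/-! ### Lower bounds for the Jensen gap. -/

section Gap

variable {E : Type*} [NormedAddCommGroup E] [InnerProductSpace ℝ E] [FiniteDimensional ℝ E]
  [MeasurableSpace E] [BorelSpace E]

/-- Lower bounds for the deficit in Jensen's inequality `∫ (P g)^r dμ ≤ ∫ P (g^r) dμ`, where `P` is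
the Gaussian smoothing and `μ` satisfies a Poincaré inequality. Here `A` is the mean square distance
between `g^(r/2)` and `(P g)^(r/2)`, and `b` the variance of `(P g)^(r/2)`. -/
lemma exists_gap_bounds {μ : Measure E} [IsProbabilityMeasure μ] {C : ℝ} (hC : 0 < C)
    (hP : PoincareC1 μ C) {σ : ℝ} (hσ : σ ≠ 0) {g : E → ℝ} (hg : Measurable g) {c₁ c₂ : ℝ}
    (hc₁ : 0 < c₁) (h₁ : ∀ x, c₁ ≤ g x) (h₂ : ∀ x, g x ≤ c₂) {p r : ℝ}
    (hpr : p.HolderConjugate r) (hr2 : r ≤ 2) {V W M : ℝ}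
    (hV : V = ∫ x, gaussSmooth σ (fun y => g y ^ r) x ∂μ)
    (hW : W = ∫ x, gaussSmooth σ g x ^ r ∂μ)
    (hM : M = ∫ x, gaussSmooth σ (fun y => g y ^ (r / 2)) x ∂μ) :
    ∃ A b : ℝ, (r - 1) * A ≤ V - W ∧ σ ^ 2 / C * (V - M ^ 2 - A) ≤ A ∧
      (r - 1) * (2 / r ^ 2) * (σ ^ 2 / C) * b ≤ V - W ∧
      ∀ η : ℝ, 0 < η → V - M ^ 2 ≤ (1 + η) * b + (1 + 1 / η) * A := by
  have hr : 1 < r := hpr.symm.lt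
  have hc₂ : 0 < c₂ := hc₁.trans_le ((h₁ 0).trans (h₂ 0))
  have hgp : ∀ x, 0 < g x := fun x => hc₁.trans_le (h₁ x)
  have hb : ∀ x, |g x| ≤ c₂ := fun x => by rw [abs_of_pos (hgp x)]; exact h₂ x
  have hbr : ∀ s : ℝ, 0 ≤ s → ∀ x, |g x ^ s| ≤ c₂ ^ s := fun s hs x => by
    rw [abs_of_pos (Real.rpow_pos_of_pos (hgp x) s)]
    exact Real.rpow_le_rpow (hgp x).le (h₂ x) hs
  have e1 : ∀ {c : ℝ}, 0 < c → (c ^ (r / 2)) ^ 2 = c ^ r := fun {c} hc => by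
    rw [← Real.rpow_natCast, ← Real.rpow_mul hc.le]; norm_num
  set G : E → ℝ := fun y => g y ^ (r / 2) with hG
  have hGm : Measurable G := hg.pow_const _
  have hGb : ∀ x, |G x| ≤ c₂ ^ (r / 2) := hbr (r / 2) (by linarith)
  have hG2 : (fun y => g y ^ r) = fun y => G y ^ 2 := funext fun y => (e1 (hgp y)).symm
  set u := gaussSmooth σ g with hu
  have hu1 : ∀ x, c₁ ≤ u x := le_gaussSmooth σ hg hb h₁
  have hu2 : ∀ x, u x ≤ c₂ := gaussSmooth_le σ hg hb h₂
  have hup : ∀ x, 0 < u x := fun x => hc₁.trans_le (hu1 x)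
  have hum : Measurable u := measurable_gaussSmooth σ hg
  set f : E → ℝ := fun x => u x ^ (r / 2) with hf
  have hfm : Measurable f := hum.pow_const _
  have hfb : ∀ x, |f x| ≤ c₂ ^ (r / 2) := fun x => by
    rw [abs_of_pos (Real.rpow_pos_of_pos (hup x) _)]
    exact Real.rpow_le_rpow (hup x).le (hu2 x) (by linarith)
  have hfp : ∀ x, 0 < f x := fun x => Real.rpow_pos_of_pos (hup x) _
  have hf2 : ∀ x, f x ^ 2 = u x ^ r := fun x => e1 (hup x)
  set Q := gaussSmooth σ G with hQ
  have hQm : Measurable Q := measurable_gaussSmooth σ hGm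
  have hQb : ∀ x, |Q x| ≤ c₂ ^ (r / 2) := abs_gaussSmooth_le σ hGb
  set S := gaussSmooth σ (fun y => G y ^ 2) with hS
  have hSb' : ∀ x, |G x ^ 2| ≤ c₂ ^ r := fun x => by
    have := hbr r (by linarith) x
    rwa [← e1 (hgp x)] at this
  have hSm : Measurable S := measurable_gaussSmooth σ (hGm.pow_const 2)
  have hSb : ∀ x, |S x| ≤ c₂ ^ r := abs_gaussSmooth_le σ hSb'
  have hmul : ∀ {F H : E → ℝ}, Measurable F → Measurable H → (∀ x, |F x| ≤ c₂ ^ (r / 2)) →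
      (∀ x, |H x| ≤ c₂ ^ (r / 2)) → Integrable (fun x => F x * H x) μ :=
    fun hF hH hFb hHb => integrable_of_abs_le (B := c₂ ^ (r / 2) * c₂ ^ (r / 2)) (hF.mul hH)
      fun x => by
        rw [abs_mul]
        exact mul_le_mul (hFb x) (hHb x) (abs_nonneg _) (by positivity)
  have iS : Integrable S μ := integrable_of_abs_le hSm hSb
  have iQ : Integrable Q μ := integrable_of_abs_le hQm hQb
  have if1 : Integrable f μ := integrable_of_abs_le hfm hfb
  have if2 : Integrable (fun x => f x ^ 2) μ := by
    simpa only [sq] using hmul hfm hfm hfb hfb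
  have iQ2 : Integrable (fun x => Q x ^ 2) μ := by
    simpa only [sq] using hmul hQm hQm hQb hQb
  have ifQ : Integrable (fun x => f x * Q x) μ := hmul hfm hQm hfb hQb
  have hV' : V = ∫ x, S x ∂μ := by rw [hV, hG2]
  have hW' : W = ∫ x, f x ^ 2 ∂μ := by rw [hW]; simp_rw [hf2]
  set X := ∫ x, f x * Q x ∂μ with hX
  set F := ∫ x, f x ∂μ with hF
  -- The mean square distance between G(x + σz) and s·f(x) + c. The case s = 1, c = 0 is A; the
  -- general case serves the variance splitting.
  have hAint : ∀ s c : ℝ, ∫ x, (S x - 2 * (s * f x + c) * Q x + (s * f x + c) ^ 2) ∂μ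
      = V - 2 * s * X - 2 * c * M + s ^ 2 * W + 2 * s * c * F + c ^ 2 := by
    intro s c
    have e : ∀ x, S x - 2 * (s * f x + c) * Q x + (s * f x + c) ^ 2
        = S x - 2 * s * (f x * Q x) - 2 * c * Q x + s ^ 2 * f x ^ 2 + 2 * s * c * f x + c ^ 2 :=
      fun x => by ring
    simp_rw [e]
    have j1 : Integrable (fun x => S x - 2 * s * (f x * Q x)) μ := iS.sub (ifQ.const_mul _)
    have j2 : Integrable (fun x => S x - 2 * s * (f x * Q x) - 2 * c * Q x) μ :=
      j1.sub (iQ.const_mul _)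
    have j3 : Integrable (fun x => S x - 2 * s * (f x * Q x) - 2 * c * Q x + s ^ 2 * f x ^ 2) μ :=
      j2.add (if2.const_mul _)
    have j4 : Integrable (fun x => S x - 2 * s * (f x * Q x) - 2 * c * Q x + s ^ 2 * f x ^ 2
      + 2 * s * c * f x) μ := j3.add (if1.const_mul _)
    rw [integral_add j4 (integrable_const _), integral_add j3 (if1.const_mul _),
      integral_add j2 (if2.const_mul _), integral_sub j1 (iQ.const_mul _),
      integral_sub iS (ifQ.const_mul _), integral_const_mul, integral_const_mul,
      integral_const_mul, integral_const_mul, ← hV', ← hW', ← hM]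
    simp [X, F]
  have hmom : ∀ (c : ℝ) (x : E), ‖gaussMoment σ G x‖ ^ 2 ≤ S x - 2 * c * Q x + c ^ 2 :=
    fun c x => norm_gaussMoment_sq_le σ hGm hGb x c
  have hnonneg : ∀ s c : ℝ, 0 ≤ V - 2 * s * X - 2 * c * M + s ^ 2 * W + 2 * s * c * F + c ^ 2 := by
    intro s c
    rw [← hAint]
    exact integral_nonneg fun x => (sq_nonneg _).trans (hmom (s * f x + c) x)
  have hA : ∫ x, (S x - 2 * f x * Q x + f x ^ 2) ∂μ = V - 2 * X + W := by
    have := hAint 1 0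
    simp only [one_mul, add_zero] at this
    rw [this]; ring
  have iA : Integrable (fun x => S x - 2 * f x * Q x + f x ^ 2) μ := by
    have : Integrable (fun x => S x - 2 * (f x * Q x) + f x ^ 2) μ :=
      (iS.sub (ifQ.const_mul 2)).add if2
    simpa only [mul_assoc] using this
  have iVW : Integrable (fun x => S x - f x ^ 2) μ := iS.sub if2
  have hVW : ∫ x, (S x - f x ^ 2) ∂μ = V - W := by rw [integral_sub iS if2, ← hV', ← hW']
  refine ⟨V - 2 * X + W, W - F ^ 2, ?_, ?_, ?_, ?_⟩
  · rw [← hA, ← hVW, ← integral_const_mul]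
    refine integral_mono (iA.const_mul _) iVW fun x => ?_
    have := gaussSmooth_rpow_sub_ge σ hg hc₁ h₁ h₂ hr hr2 x
    rw [hG2] at this
    simpa only [hf2] using this
  -- Here V - M² - A ≤ Var(Q), because A is the mean conditional variance of G plus ∫ (Q - f)². The
  -- Poincaré inequality for Q closes the estimate, since Bessel gives ‖σ∇Q‖² ≤ P((G - f(x))²)(x),
  -- whose integral is A.
  · have hfd := fderiv_gaussSmooth hσ hGm hGb
    have hσ2 : 0 < σ ^ 2 := by positivity
    have hn : ∀ x, ‖fderiv ℝ Q x‖ ^ 2 = (σ ^ 2)⁻¹ * ‖gaussMoment σ G x‖ ^ 2 := fun x => by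
      rw [hQ, hfd]
      simp only [innerSL_apply_norm]
      rw [norm_smul, mul_pow, Real.norm_eq_abs, sq_abs, inv_pow]
    have hn2 : ∀ x, ‖fderiv ℝ Q x‖
        ≤ |σ⁻¹| * (c₂ ^ (r / 2) * ∫ z : E, ‖z‖ ^ 1 ∂(stdGaussian E)) := fun x => by
      rw [hQ, hfd]
      simp only [innerSL_apply_norm]
      rw [norm_smul, Real.norm_eq_abs]
      gcongr
      exact norm_gaussMoment_le σ hGb x
    have hp := hP Q _ _ (contDiff_gaussSmooth hσ hGm hGb) hQb hn2
    have h3 : ∫ x, ‖fderiv ℝ Q x‖ ^ 2 ∂μ ≤ (σ ^ 2)⁻¹ * (V - 2 * X + W) := by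
      rw [← hA, ← integral_const_mul]
      refine integral_mono_of_nonneg (.of_forall fun x => sq_nonneg _) (iA.const_mul _)
        (.of_forall fun x => ?_)
      simp only [hn]
      gcongr
      exact hmom (f x) x
    have h4 : 0 ≤ ∫ x, (Q x - f x) ^ 2 ∂μ := integral_nonneg fun _ => sq_nonneg _
    have h5 : ∫ x, (Q x - f x) ^ 2 ∂μ = (∫ x, Q x ^ 2 ∂μ) - 2 * X + W := by
      have e : ∀ x, (Q x - f x) ^ 2 = Q x ^ 2 - 2 * (f x * Q x) + f x ^ 2 := fun x => by ring
      have j : Integrable (fun x => Q x ^ 2 - 2 * (f x * Q x)) μ := iQ2.sub (ifQ.const_mul 2)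
      simp_rw [e]
      rw [integral_add j if2, integral_sub iQ2 (ifQ.const_mul 2),
        integral_const_mul, ← hW']
    rw [h5] at h4
    rw [← hM] at hp
    have h6 : V - M ^ 2 - (V - 2 * X + W) ≤ C * ((σ ^ 2)⁻¹ * (V - 2 * X + W)) := by
      have := mul_le_mul_of_nonneg_left h3 hC.le
      linarith
    calc σ ^ 2 / C * (V - M ^ 2 - (V - 2 * X + W))
        ≤ σ ^ 2 / C * (C * ((σ ^ 2)⁻¹ * (V - 2 * X + W))) := by gcongr
      _ = _ := by field_simp
  -- The Poincaré inequality for f = u^(r/2): ‖∇f‖² is a multiple of u^(r-2)‖E[g(x + σz) z]‖², which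
  -- the reverse local inequality `gaussSmooth_rpow_ge` bounds by S - f².
  · have hσ2 : 0 < σ ^ 2 := by positivity
    have hfd : ∀ x, HasFDerivAt f ((r / 2 * u x ^ (r / 2 - 1)) •
        innerSL ℝ (σ⁻¹ • gaussMoment σ g x)) x := fun x =>
      (hasFDerivAt_gaussSmooth hσ hg hb x).rpow_const (Or.inl (hup x).ne')
    have hn1 : ∀ x, ‖fderiv ℝ f x‖
        = r / 2 * u x ^ (r / 2 - 1) * (|σ⁻¹| * ‖gaussMoment σ g x‖) := fun x => by
      rw [(hfd x).fderiv, norm_smul, innerSL_apply_norm, norm_smul, Real.norm_eq_abs,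
        Real.norm_eq_abs, abs_of_pos]
      have := Real.rpow_pos_of_pos (hup x) (r / 2 - 1)
      positivity
    have hn : ∀ x, ‖fderiv ℝ f x‖ ^ 2
        = (r ^ 2 / 4) * (σ ^ 2)⁻¹ * (u x ^ (r - 2) * ‖gaussMoment σ g x‖ ^ 2) := fun x => by
      have e2 : (u x ^ (r / 2 - 1)) ^ 2 = u x ^ (r - 2) := by
        rw [← Real.rpow_natCast, ← Real.rpow_mul (hup x).le]; congr 1; push_cast; ring
      rw [hn1, mul_pow, mul_pow, mul_pow, sq_abs, e2, inv_pow]; ring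
    have hn2 : ∀ x, ‖fderiv ℝ f x‖ ≤ r / 2 * c₁ ^ (r / 2 - 1)
        * (|σ⁻¹| * (c₂ * ∫ z : E, ‖z‖ ^ 1 ∂(stdGaussian E))) := fun x => by
      rw [hn1]
      have h3 : u x ^ (r / 2 - 1) ≤ c₁ ^ (r / 2 - 1) :=
        Real.rpow_le_rpow_of_nonpos hc₁ (hu1 x) (by linarith)
      gcongr
      exact norm_gaussMoment_le σ hb x
    have hfc : ContDiff ℝ 1 f :=
      (contDiff_gaussSmooth hσ hg hb).rpow_const_of_ne fun x => (hup x).ne'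
    have hp := hP f _ _ hfc hfb hn2
    rw [← hW', ← hF] at hp
    have h3 : ∫ x, ‖fderiv ℝ f x‖ ^ 2 ∂μ ≤ (r ^ 2 / 4) * (σ ^ 2)⁻¹ * (2 / (r - 1)) * (V - W) := by
      rw [← hVW, ← integral_const_mul]
      refine integral_mono_of_nonneg (.of_forall fun x => sq_nonneg _) (iVW.const_mul _)
        (.of_forall fun x => ?_)
      simp only [hn]
      rw [mul_assoc (r ^ 2 / 4 * (σ ^ 2)⁻¹)]
      refine mul_le_mul_of_nonneg_left ?_ (by positivity)
      have h4 := gaussSmooth_rpow_ge σ hg hc₁ h₁ h₂ hpr x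
      rw [hG2, ← hu, ← hf2, ← hS] at h4
      have hr1 : 0 < r - 1 := by linarith
      rw [div_mul_eq_mul_div, le_div_iff₀ hr1]
      linarith
    have h4 := mul_le_mul_of_nonneg_left h3 hC.le
    have hr1 : 0 < r - 1 := by linarith
    calc (r - 1) * (2 / r ^ 2) * (σ ^ 2 / C) * (W - F ^ 2)
        ≤ (r - 1) * (2 / r ^ 2) * (σ ^ 2 / C)
          * (C * ((r ^ 2 / 4) * (σ ^ 2)⁻¹ * (2 / (r - 1)) * (V - W))) := by
            gcongr
            linarith
      _ = V - W := by field_simp; ring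
  · intro η hη
    -- The defect in the splitting is the exact sum of (1/η)‖(G - M) - (1+η)(f - F)‖² and (1 +
    -- 1/η)(M - F)²; these s and c produce the first square.
    have h := hnonneg (1 + η) (M - (1 + η) * F)
    have h2 := sq_nonneg (M - F)
    have h3 : (1 + η) * (W - F ^ 2) + (1 + 1 / η) * (V - 2 * X + W) - (V - M ^ 2)
        = (1 / η) * (V - 2 * (1 + η) * X - 2 * (M - (1 + η) * F) * M + (1 + η) ^ 2 * W
          + 2 * (1 + η) * (M - (1 + η) * F) * F + (M - (1 + η) * F) ^ 2)
          + (1 + 1 / η) * (M - F) ^ 2 := by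
      field_simp; ring
    have h4 : 0 ≤ (1 / η) * (V - 2 * (1 + η) * X - 2 * (M - (1 + η) * F) * M + (1 + η) ^ 2 * W
          + 2 * (1 + η) * (M - (1 + η) * F) * F + (M - (1 + η) * F) ^ 2)
          + (1 + 1 / η) * (M - F) ^ 2 := by positivity
    linarith

end Gap

/-! ### One small Gaussian step. -/

section Substep

/-- With s = ρV, it suffices that p(V - W) ≥ 0.8342·t·s, where 0.8342 exceeds 1.001·(5/6). If A is
already of that size, use p(V - W) ≥ rA. Otherwise t ≤ 1/5000 makes A negligible against s, so the
variance V - M² ≥ 0.632·s sits almost entirely in b, and either the second or the third gap bound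
applies. -/
lemma jensen_gap_ge {p r t V W M A b ρ : ℝ} (hpr : p.HolderConjugate r)
    (ht : 0 < t) (ht' : t ≤ 1 / 5000) (hV : 0 < V) (hρ : 0 ≤ ρ)
    (hM : M ^ 2 ≤ V * (1 - 0.632 * ρ)) (h1 : (r - 1) * A ≤ V - W)
    (h2 : t * (V - M ^ 2 - A) ≤ A) (h3 : (r - 1) * (2 / r ^ 2) * t * b ≤ V - W)
    (h4 : V - M ^ 2 ≤ (1 + 0.02) * b + (1 + 1 / 0.02) * A) :
    (Real.exp (5 / 6 * (t / p)) - 1) * ρ * V ≤ V - W := by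
  have hp : 1 < p := hpr.lt
  have hr : 1 < r := hpr.symm.lt
  have hp0 : 0 < p := hpr.pos
  have hr1 : r = (r - 1) * p := by
    have := hpr.symm.sub_one_mul_conj
    linarith
  set s := ρ * V with hs
  have hs0 : 0 ≤ s := by positivity
  set z := 5 / 6 * (t / p) with hz
  have hz0 : 0 < z := by positivity
  have hpz : p * z = 5 / 6 * t := by rw [hz]; field_simp
  have hz1 : z ≤ 1 / 6000 := by nlinarith
  have hexp : Real.exp z - 1 ≤ z * 1.001 := by
    have h := Real.abs_exp_sub_one_sub_id_le (x := z) (by rw [abs_of_pos hz0]; linarith)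
    have := (abs_le.1 h).2
    nlinarith
  have hY : p * (Real.exp z - 1) ≤ 0.8342 * t := by nlinarith
  suffices h : 0.8342 * t * s ≤ p * (V - W) by
    have h5 : p * ((Real.exp z - 1) * ρ * V) ≤ p * (V - W) := by
      calc p * ((Real.exp z - 1) * ρ * V) = p * (Real.exp z - 1) * s := by rw [hs]; ring
        _ ≤ 0.8342 * t * s := by gcongr
        _ ≤ _ := h
    exact le_of_mul_le_mul_left h5 hp0
  have g1 : r * A ≤ p * (V - W) := by
    calc r * A = p * ((r - 1) * A) := by rw [← mul_assoc, mul_comm p, ← hr1]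
      _ ≤ _ := by gcongr
  have ha : 0.632 * s ≤ V - M ^ 2 := by rw [hs]; linarith
  by_cases hA : 0.8342 * t * s ≤ A
  · have : 0 ≤ A := le_trans (by positivity) hA
    nlinarith
  push Not at hA
  have hts : t * s ≤ 1 / 5000 * s := by gcongr
  have hA' : A ≤ 0.00017 * s := by nlinarith
  have hA0 : 0 ≤ A := by
    refine le_trans ?_ h2
    have : 0 ≤ V - M ^ 2 - A := by linarith
    positivity
  -- The second bound gives about 0.632·r·t·s and the third about 0.611·(2/r)·t·s. The threshold is
  -- near √2, where r = 2/r, and both constants then exceed 0.8342.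
  by_cases hr2 : 1.41 ≤ r
  · have h5 : t * (0.6318 * s) ≤ A := by
      refine le_trans ?_ h2
      gcongr
      linarith
    have h6 : 1.41 * A ≤ r * A := by gcongr
    nlinarith [mul_nonneg ht.le hs0]
  · push Not at hr2
    have hb : 0.611 * s ≤ b := by norm_num at h4; linarith
    have g3 : 2 / r * t * b ≤ p * (V - W) := by
      have e : 2 / r * t * b = p * ((r - 1) * (2 / r ^ 2) * t * b) := by
        have hr0 : r ≠ 0 := by linarith
        calc 2 / r * t * b = r * (2 / r ^ 2) * t * b := by field_simp
          _ = (r - 1) * p * (2 / r ^ 2) * t * b := by rw [← hr1]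
          _ = _ := by ring
      rw [e]
      gcongr
    have h5 : 1.418 ≤ 2 / r := by
      rw [le_div_iff₀ (by linarith)]; linarith
    have h6 : 1.418 * t * (0.611 * s) ≤ 2 / r * t * b := by gcongr
    nlinarith [mul_nonneg ht.le hs0]

/-- On [0, 1] the convex function e^(-R) lies below its chord, of slope -(1 - 1/e), and 0.632 < 1 -
1/e. -/
lemma exp_neg_le_of_nonneg {R : ℝ} (hR : 0 ≤ R) : Real.exp (-R) ≤ 1 - 0.632 * min 1 R := by
  have he : Real.exp (-1) ≤ 0.368 := by
    have := Real.exp_neg_one_lt_d9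
    linarith
  rcases le_total 1 R with h | h
  · rw [min_eq_left h]
    have : Real.exp (-R) ≤ Real.exp (-1) := Real.exp_le_exp.2 (by linarith)
    linarith
  · rw [min_eq_right h]
    have hc := convexOn_exp.2 (Set.mem_univ (0 : ℝ)) (Set.mem_univ (-1 : ℝ))
      (by linarith : 0 ≤ 1 - R) hR (by ring)
    simp only [smul_eq_mul, mul_zero, zero_add, Real.exp_zero, mul_one, mul_neg] at hc
    nlinarith

variable {α : Type*} [MeasurableSpace α]

lemma one_le_integral_rpow {μ : Measure α} [IsProbabilityMeasure μ] {h : α → ℝ} {p : ℝ}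
    (hp : 1 ≤ p) (hpos : ∀ x, 0 ≤ h x) (hi : Integrable h μ)
    (hip : Integrable (fun x => h x ^ p) μ) (h1 : ∫ x, h x ∂μ = 1) :
    1 ≤ ∫ x, h x ^ p ∂μ := by
  have h2 : ∀ x, 1 + p * (h x - 1) ≤ h x ^ p := fun x => by
    have := one_add_mul_self_le_rpow_one_add (s := h x - 1) (by linarith [hpos x]) hp
    simpa using this
  have i2 : Integrable (fun x => p * (h x - 1)) μ := (hi.sub (integrable_const 1)).const_mul p
  have h3 := integral_mono ((integrable_const (1 : ℝ)).add i2) hip h2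
  simp only [Pi.add_apply] at h3
  rw [integral_add (integrable_const _) i2, integral_const_mul,
    integral_sub hi (integrable_const _), h1] at h3
  simpa using h3

/-- Interpolation between the first and the `p`-th moment of a probability density. -/
lemma sq_integral_rpow_half_le {μ : Measure α} [IsProbabilityMeasure μ] {h : α → ℝ} {p : ℝ}
    (hp : 2 < p) (hpos : ∀ x, 0 < h x) (hi : Integrable h μ)
    (hip : Integrable (fun x => h x ^ p) μ) (h1 : ∫ x, h x ∂μ = 1) :
    1 ≤ ∫ x, h x ^ p ∂μ ∧ (∫ x, h x ^ (p / 2) ∂μ) ^ 2 ≤ (∫ x, h x ^ p ∂μ)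
      * Real.exp (-(Real.log (∫ x, h x ^ p ∂μ) / (p - 1))) := by
  set V := ∫ x, h x ^ p ∂μ with hV
  have hV1 : 1 ≤ V :=
    one_le_integral_rpow (by linarith) (fun x => (hpos x).le) hi hip h1
  have hV0 : 0 < V := by linarith
  refine ⟨hV1, ?_⟩
  -- The interpolation exponent solving (1 - w) + pw = p/2. AM–GM between h and h^p/V has total mass
  -- 1, giving ∫ h^(p/2) ≤ V^w, and 2w = 1 - 1/(p-1).
  set w := (p / 2 - 1) / (p - 1) with hw
  have hp1 : 0 < p - 1 := by linarith
  have hw0 : 0 ≤ w := div_nonneg (by linarith) hp1.le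
  have hw1 : 0 ≤ 1 - w := by
    rw [hw, sub_nonneg, div_le_one hp1]; linarith
  have key : ∀ x, V ^ (-w) * h x ^ (p / 2) ≤ (1 - w) * h x + w / V * h x ^ p := by
    intro x
    have hx := hpos x
    have := Real.geom_mean_le_arith_mean2_weighted hw1 hw0 hx.le
      (div_pos (Real.rpow_pos_of_pos hx p) hV0).le (by ring)
    rw [Real.div_rpow (Real.rpow_pos_of_pos hx p).le hV0.le, ← Real.rpow_mul hx.le,
      ← mul_div_assoc, ← Real.rpow_add hx] at this
    have e : 1 - w + p * w = p / 2 := by rw [hw]; field_simp; ring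
    rw [e] at this
    rw [Real.rpow_neg hV0.le]
    calc _ = h x ^ (p / 2) / V ^ w := (div_eq_inv_mul _ _).symm
      _ ≤ _ := this
      _ = _ := by ring
  have h4 := integral_mono_of_nonneg (μ := μ) (.of_forall fun x =>
    mul_nonneg (Real.rpow_nonneg hV0.le _) (Real.rpow_nonneg (hpos x).le _))
    ((hi.const_mul (1 - w)).add (hip.const_mul (w / V))) (.of_forall key)
  simp only [Pi.add_apply] at h4
  rw [integral_add (hi.const_mul _) (hip.const_mul _), integral_const_mul, integral_const_mul,
    integral_const_mul, h1, ← hV, div_mul_cancel₀ _ hV0.ne', Real.rpow_neg hV0.le] at h4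
  have hVw : 0 < V ^ w := Real.rpow_pos_of_pos hV0 w
  have h5 : ∫ x, h x ^ (p / 2) ∂μ ≤ V ^ w := by
    rw [inv_mul_le_iff₀ hVw] at h4; linarith
  have h6 : 0 ≤ ∫ x, h x ^ (p / 2) ∂μ :=
    integral_nonneg fun x => Real.rpow_nonneg (hpos x).le _
  calc (∫ x, h x ^ (p / 2) ∂μ) ^ 2 ≤ (V ^ w) ^ 2 := by gcongr
    _ = Real.exp (Real.log V * (w * 2)) := by
      rw [← Real.rpow_natCast, ← Real.rpow_mul hV0.le, Real.rpow_def_of_pos hV0]; norm_num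
    _ = V * Real.exp (-(Real.log V / (p - 1))) := by
      nth_rewrite 2 [← Real.exp_log hV0]
      rw [← Real.exp_add, hw]
      congr 1
      field_simp
      ring

variable {E : Type*} [NormedAddCommGroup E] [InnerProductSpace ℝ E] [FiniteDimensional ℝ E]
  [MeasurableSpace E] [BorelSpace E]

/-- Evolution of the density is dual to Gaussian smoothing of test functions; this links h' to h
without a formula for h'. -/
lemma integral_mul_density_gaussConv {μ : Measure E} [IsProbabilityMeasure μ] {σ : ℝ}
    {h h' : E → ℝ} (hm : Measurable h) (hm' : Measurable h') {B : ℝ} (hB : ∀ x, |h x| ≤ B)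
    (hpos : ∀ x, 0 ≤ h x) (hpos' : ∀ x, 0 ≤ h' x)
    (hρ : gaussConv σ (μ.withDensity fun x => ENNReal.ofReal (h x))
      = (gaussConv σ μ).withDensity fun x => ENNReal.ofReal (h' x))
    {F : E → ℝ} (hF : Measurable F) {b : ℝ} (hb : ∀ x, |F x| ≤ b) :
    ∫ y, h' y * F y ∂(gaussConv σ μ) = ∫ x, h x * gaussSmooth σ F x ∂μ := by
  have : IsFiniteMeasure (μ.withDensity fun x => ENNReal.ofReal (h x)) :=
    isFiniteMeasure_withDensity_ofReal (integrable_of_abs_le hm hB).2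
  have h1 := integral_gaussConv σ (μ.withDensity fun x => ENNReal.ofReal (h x)) hF hb
  rw [hρ, integral_withDensity_eq_integral_toReal_smul (by fun_prop) (.of_forall fun _ => by simp),
    integral_withDensity_eq_integral_toReal_smul (by fun_prop) (.of_forall fun _ => by simp)] at h1
  simpa only [ENNReal.toReal_ofReal (hpos _), ENNReal.toReal_ofReal (hpos' _), smul_eq_mul]
    using h1

/-- Decrease of the Rényi divergence of order `p` along a small Gaussian convolution, for densities
bounded above and away from zero. -/
lemma renyi_gaussConv_small_step {μ : Measure E} [IsProbabilityMeasure μ] {C : ℝ} (hC : 0 < C)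
    (hP : PoincareC1 μ C) {σ : ℝ} (hσ : σ ≠ 0) (hσC : σ ^ 2 / C ≤ 1 / 5000) {p : ℝ} (hp : 2 < p)
    {h h' : E → ℝ} (hm : Measurable h) (hm' : Measurable h') {c₁ c₂ : ℝ} (hc₁ : 0 < c₁)
    (hb₁ : ∀ x, c₁ ≤ h x) (hb₂ : ∀ x, h x ≤ c₂) (hb₁' : ∀ x, c₁ ≤ h' x) (hb₂' : ∀ x, h' x ≤ c₂)
    (h1 : ∫ x, h x ∂μ = 1)
    (hρ : gaussConv σ (μ.withDensity fun x => ENNReal.ofReal (h x))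
      = (gaussConv σ μ).withDensity fun x => ENNReal.ofReal (h' x)) {R R' : ℝ}
    (hR : R = Real.log (∫ x, h x ^ p ∂μ) / (p - 1))
    (hR' : R' = Real.log (∫ x, h' x ^ p ∂(gaussConv σ μ)) / (p - 1)) :
    ∫ x, h' x ∂(gaussConv σ μ) = 1 ∧
    R' + (Real.exp (5 / 6 * (σ ^ 2 / C / p)) - 1) * min 1 R' ≤ R := by
  have hp0 : 0 < p := by linarith
  have hp1 : 0 < p - 1 := by linarith
  have hpr : p.HolderConjugate (Real.conjExponent p) := .conjExponent (by linarith)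
  set r := Real.conjExponent p with hrdef
  have hr : 1 < r := hpr.symm.lt
  have hre : r * (p - 1) = p := by rw [hrdef, Real.conjExponent]; field_simp
  -- The order p = 2q exceeds 2, so the conjugate exponent lies in the range where the Bregman bound
  -- holds.
  have hr2 : r ≤ 2 := by
    by_contra hcon
    push Not at hcon
    nlinarith
  have hc₂ : 0 < c₂ := hc₁.trans_le ((hb₁ 0).trans (hb₂ 0))
  have hpos : ∀ x, 0 < h x := fun x => hc₁.trans_le (hb₁ x)
  have hpos' : ∀ x, 0 < h' x := fun x => hc₁.trans_le (hb₁' x)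
  have hab : ∀ x, |h x| ≤ c₂ := fun x => by rw [abs_of_pos (hpos x)]; exact hb₂ x
  have hab' : ∀ x, |h' x| ≤ c₂ := fun x => by rw [abs_of_pos (hpos' x)]; exact hb₂' x
  have habr : ∀ s : ℝ, 0 ≤ s → ∀ x, |h x ^ s| ≤ c₂ ^ s := fun s hs x => by
    rw [abs_of_pos (Real.rpow_pos_of_pos (hpos x) s)]
    exact Real.rpow_le_rpow (hpos x).le (hb₂ x) hs
  have habr' : ∀ s : ℝ, 0 ≤ s → ∀ x, |h' x ^ s| ≤ c₂ ^ s := fun s hs x => by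
    rw [abs_of_pos (Real.rpow_pos_of_pos (hpos' x) s)]
    exact Real.rpow_le_rpow (hpos' x).le (hb₂' x) hs
  set μ' := gaussConv σ μ with hμ'
  have hdual := fun {F : E → ℝ} {b : ℝ} (hF : Measurable F) (hb : ∀ x, |F x| ≤ b) =>
    integral_mul_density_gaussConv hm hm' hab (fun x => (hpos x).le) (fun x => (hpos' x).le) hρ
      hF hb
  have hone : ∫ x, h' x ∂μ' = 1 := by
    have := hdual (F := fun _ => 1) (b := 1) measurable_const (by simp)
    simpa [gaussSmooth, h1] using this
  refine ⟨hone, ?_⟩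
  obtain ⟨hV1, hMV⟩ := sq_integral_rpow_half_le hp hpos' (integrable_of_abs_le hm' hab')
    (integrable_of_abs_le (hm'.pow_const p) (habr' p hp0.le)) hone
  obtain ⟨hU1, -⟩ := sq_integral_rpow_half_le hp hpos (integrable_of_abs_le hm hab)
    (integrable_of_abs_le (hm.pow_const p) (habr p hp0.le)) h1
  rw [← hR'] at hMV
  set V' := ∫ x, h' x ^ p ∂μ' with hV'
  set V := ∫ x, h x ^ p ∂μ with hV
  -- The extremal function for the duality of Lᵖ and Lʳ: h'·g = g^r = h'^p and g^(r/2) = h'^(p/2).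
  set g : E → ℝ := fun y => h' y ^ (p - 1) with hg
  have hgm : Measurable g := hm'.pow_const _
  have hg1 : ∀ x, c₁ ^ (p - 1) ≤ g x := fun x => Real.rpow_le_rpow hc₁.le (hb₁' x) hp1.le
  have hg2 : ∀ x, g x ≤ c₂ ^ (p - 1) := fun x => Real.rpow_le_rpow (hpos' x).le (hb₂' x) hp1.le
  have hgr : (fun y => g y ^ r) = fun y => h' y ^ p := by
    funext y
    rw [hg, ← Real.rpow_mul (hpos' y).le]; congr 1; linarith
  have hgr2 : (fun y => g y ^ (r / 2)) = fun y => h' y ^ (p / 2) := by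
    funext y
    rw [hg, ← Real.rpow_mul (hpos' y).le]; congr 1; linarith
  have hVg : V' = ∫ x, gaussSmooth σ (fun y => g y ^ r) x ∂μ := by
    rw [hgr, hV', hμ', integral_gaussConv σ μ (hm'.pow_const p) (habr' p hp0.le)]
  have hMg : ∫ x, h' x ^ (p / 2) ∂μ' = ∫ x, gaussSmooth σ (fun y => g y ^ (r / 2)) x ∂μ := by
    rw [hgr2, hμ', integral_gaussConv σ μ (hm'.pow_const (p / 2)) (habr' (p / 2) (by linarith))]
  set W := ∫ x, gaussSmooth σ g x ^ r ∂μ with hW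
  obtain ⟨A, b, b1, b2, b3, b4⟩ := exists_gap_bounds hC hP hσ hgm
    (Real.rpow_pos_of_pos hc₁ _) hg1 hg2 hpr hr2 hVg hW hMg
  have hV0 : 0 < V' := by linarith
  have hR0 : 0 ≤ R' := by rw [hR']; exact div_nonneg (Real.log_nonneg hV1) hp1.le
  have ht : 0 < σ ^ 2 / C := by positivity
  have hgap := jensen_gap_ge (ρ := min 1 R') hpr ht hσC hV0 (le_min zero_le_one hR0)
    (hMV.trans (by gcongr; exact exp_neg_le_of_nonneg hR0)) b1 b2 b3
    (b4 0.02 (by norm_num))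
  set Y := (Real.exp (5 / 6 * (σ ^ 2 / C / p)) - 1) * min 1 R' with hY
  have hgb : ∀ x, |g x| ≤ c₂ ^ (p - 1) := fun x => by
    rw [abs_of_pos (Real.rpow_pos_of_pos (hpos' x) _)]; exact hg2 x
  have hup : ∀ x, 0 < gaussSmooth σ g x := fun x =>
    (Real.rpow_pos_of_pos hc₁ _).trans_le (le_gaussSmooth σ hgm hgb hg1 x)
  have hub : ∀ x, |gaussSmooth σ g x| ≤ c₂ ^ (p - 1) := abs_gaussSmooth_le σ hgb
  have hum : Measurable (gaussSmooth σ g) := measurable_gaussSmooth σ hgm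
  have hVh : V' = ∫ x, h x * gaussSmooth σ g x ∂μ := by
    rw [← hdual hgm hgb, hV']
    refine integral_congr_ae (.of_forall fun y => ?_)
    simp only [hg]
    rw [mul_comm, ← Real.rpow_add_one (hpos' y).ne']
    congr 1; ring
  have hhol := integral_mul_le_Lp_mul_Lq_of_nonneg (μ := μ) hpr
    (.of_forall fun x => (hpos x).le) (.of_forall fun x => (hup x).le)
    (MemLp.of_bound hm.aestronglyMeasurable c₂ (.of_forall hab))
    (MemLp.of_bound hum.aestronglyMeasurable _ (.of_forall hub))
  rw [← hVh, ← hV, ← hW] at hhol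
  have hW0 : 0 < W := by
    by_contra hcon
    push Not at hcon
    have h0 : W = 0 := le_antisymm hcon (integral_nonneg fun x => Real.rpow_nonneg (hup x).le _)
    rw [h0, Real.zero_rpow (by positivity), mul_zero] at hhol
    linarith
  have hlog := Real.log_le_log hV0 hhol
  rw [Real.log_mul (Real.rpow_pos_of_pos (by linarith) _).ne' (Real.rpow_pos_of_pos hW0 _).ne',
    Real.log_rpow (by linarith), Real.log_rpow hW0] at hlog
  -- The gap gives W ≤ V'(1 - Y). Inserted in Hölder, p log V' ≤ log V + (p-1)(log V' - Y), which is
  -- R' + Y ≤ R after division by p - 1.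
  have hWle : W ≤ V' * Real.exp (-Y) := by
    have := Real.add_one_le_exp (-Y)
    nlinarith
  have hlogW := Real.log_le_log hW0 hWle
  rw [Real.log_mul hV0.ne' (Real.exp_pos _).ne', Real.log_exp] at hlogW
  have hrp : 1 / r = (p - 1) / p := by rw [hrdef, Real.conjExponent]; field_simp
  rw [hrp] at hlog
  have h6 : p * Real.log V' ≤ Real.log V + (p - 1) * (Real.log V' - Y) := by
    have h7 : (p - 1) / p * Real.log W ≤ (p - 1) / p * (Real.log V' + -Y) := by gcongr
    have h8 : p * Real.log V' ≤ p * (1 / p * Real.log V + (p - 1) / p * (Real.log V' + -Y)) := by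
      gcongr; linarith
    calc _ ≤ _ := h8
      _ = _ := by field_simp; ring
  rw [hR', hR, div_add' _ _ _ hp1.ne', div_le_div_iff_of_pos_right hp1]
  linarith

end Substep

/-! ### Composition of small steps into one Gaussian of variance 2ε. -/

section Iteration

/-- The function `θ ↦ 1 + θ` on `[0, ∞)`, extended by `θ ↦ e^θ` on `(-∞, 0]`. -/
noncomputable def linExp (θ : ℝ) : ℝ := max θ 0 + Real.exp (min θ 0)

lemma linExp_of_nonneg {θ : ℝ} (h : 0 ≤ θ) : linExp θ = 1 + θ := by
  rw [linExp, max_eq_left h, min_eq_right h, Real.exp_zero, add_comm]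

lemma linExp_of_nonpos {θ : ℝ} (h : θ ≤ 0) : linExp θ = Real.exp θ := by
  rw [linExp, max_eq_right h, min_eq_left h, zero_add]

lemma continuous_linExp : Continuous linExp := by
  unfold linExp; fun_prop

lemma linExp_strictMono : StrictMono linExp := by
  intro a b hab
  rcases le_total 0 a with ha | ha
  · rw [linExp_of_nonneg ha, linExp_of_nonneg (ha.trans hab.le)]; linarith
  · rw [linExp_of_nonpos ha]
    rcases le_total 0 b with hb | hb
    · rw [linExp_of_nonneg hb]
      rcases hb.eq_or_lt with rfl | hb'
      · simpa using Real.exp_lt_exp.2 hab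
      · have : Real.exp a ≤ 1 := Real.exp_le_one_iff.2 ha
        linarith
    · rw [linExp_of_nonpos hb]; exact Real.exp_lt_exp.2 hab

/-- The recursion is increasing in R', so it is enough that `linExp` satisfies linExp θ ≤ linExp (θ
- z) + (e^z - 1) min(1, linExp (θ - z)). This is an equality on the exponential branch and follows
from e^z ≥ 1 + z elsewhere. -/
lemma le_linExp_sub {R R' θ z : ℝ} (hz : 0 ≤ z)
    (h : R' + (Real.exp z - 1) * min 1 R' ≤ R) (hR : R ≤ linExp θ) : R' ≤ linExp (θ - z) := by
  by_contra hcon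
  push Not at hcon
  have hz1 : 0 ≤ Real.exp z - 1 := by linarith [Real.one_le_exp hz]
  have h1 : linExp (θ - z) + (Real.exp z - 1) * min 1 (linExp (θ - z)) < R := by
    have : min 1 (linExp (θ - z)) ≤ min 1 R' := min_le_min_left _ hcon.le
    have := mul_le_mul_of_nonneg_left this hz1
    linarith
  have h2 : linExp θ ≤ linExp (θ - z) + (Real.exp z - 1) * min 1 (linExp (θ - z)) := by
    rcases le_total 0 (θ - z) with h0 | h0
    · rw [linExp_of_nonneg h0, linExp_of_nonneg (by linarith), min_eq_left (by linarith)]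
      linarith [Real.add_one_le_exp z]
    · have he : Real.exp (θ - z) ≤ 1 := Real.exp_le_one_iff.2 h0
      rw [linExp_of_nonpos h0, min_eq_right he]
      have e : Real.exp (θ - z) + (Real.exp z - 1) * Real.exp (θ - z) = Real.exp θ := by
        have : Real.exp z * Real.exp (θ - z) = Real.exp θ := by rw [← Real.exp_add]; congr 1; ring
        linarith
      rw [e]
      rcases le_total 0 θ with h3 | h3
      · rw [linExp_of_nonneg h3]; linarith [Real.add_one_le_exp θ]
      · rw [linExp_of_nonpos h3]
  linarith

lemma exists_bounded_density {α : Type*} [MeasurableSpace α] {μ ν : Measure α} [IsFiniteMeasure μ]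
    [IsFiniteMeasure ν] {c₁ c₂ : ℝ} (h0 : 0 ≤ c₁) (h12 : c₁ ≤ c₂)
    (h₁ : ∀ s, MeasurableSet s → ENNReal.ofReal c₁ * μ s ≤ ν s)
    (h₂ : ∀ s, MeasurableSet s → ν s ≤ ENNReal.ofReal c₂ * μ s) :
    ∃ h : α → ℝ, Measurable h ∧ (∀ x, c₁ ≤ h x) ∧ (∀ x, h x ≤ c₂) ∧
      ν = μ.withDensity fun x => ENNReal.ofReal (h x) := by
  have hac : ν ≪ μ := Measure.AbsolutelyContinuous.mk fun s hs h => by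
    have := h₂ s hs
    rw [h, mul_zero] at this
    exact le_antisymm this bot_le
  have hmD := Measure.measurable_rnDeriv ν μ
  have hD : ∀ s, ∫⁻ x in s, ν.rnDeriv μ x ∂μ = ν s := fun s => Measure.setLIntegral_rnDeriv hac s
  have a1 : ∀ᵐ x ∂μ, ENNReal.ofReal c₁ ≤ ν.rnDeriv μ x :=
    ae_le_of_forall_setLIntegral_le_of_sigmaFinite measurable_const fun s hs _ => by
      rw [hD, setLIntegral_const]; exact h₁ s hs
  have a2 : ∀ᵐ x ∂μ, ν.rnDeriv μ x ≤ ENNReal.ofReal c₂ :=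
    ae_le_of_forall_setLIntegral_le_of_sigmaFinite hmD fun s hs _ => by
      rw [hD, setLIntegral_const]; exact h₂ s hs
  -- Clamping changes the derivative only on a null set and makes the bounds hold at every point.
  refine ⟨fun x => max c₁ (min c₂ (ν.rnDeriv μ x).toReal), by fun_prop,
    fun x => le_max_left _ _, fun x => max_le h12 (min_le_left _ _), ?_⟩
  rw [← Measure.withDensity_rnDeriv_eq ν μ hac]
  refine withDensity_congr_ae ?_
  rw [Measure.withDensity_rnDeriv_eq ν μ hac]
  filter_upwards [a1, a2] with x hx1 hx2
  have hne : ν.rnDeriv μ x ≠ ⊤ := (hx2.trans_lt ENNReal.ofReal_lt_top).ne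
  have b1 : c₁ ≤ (ν.rnDeriv μ x).toReal := (ENNReal.ofReal_le_iff_le_toReal hne).1 hx1
  have b2 : (ν.rnDeriv μ x).toReal ≤ c₂ := ENNReal.toReal_le_of_le_ofReal (h0.trans h12) hx2
  rw [min_eq_right b2, max_eq_right b1, ENNReal.ofReal_toReal hne]

variable {E : Type*} [NormedAddCommGroup E] [InnerProductSpace ℝ E] [FiniteDimensional ℝ E]
  [MeasurableSpace E] [BorelSpace E]

lemma gaussConv_apply (σ : ℝ) (μ : Measure E) {s : Set E} (hs : MeasurableSet s) :
    gaussConv σ μ s = ∫⁻ x, ∫⁻ z, s.indicator 1 (x + σ • z) ∂(stdGaussian E) ∂μ := by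
  rw [← lintegral_indicator_one hs, lintegral_gaussConv σ μ (measurable_one.indicator hs)]

lemma measurable_lintegral_comp_add_smul (σ : ℝ) {F : E → ℝ≥0∞} (hF : Measurable F) :
    Measurable fun x => ∫⁻ z, F (x + σ • z) ∂(stdGaussian E) :=
  Measurable.lintegral_prod_right' (f := fun p : E × E => F (p.1 + σ • p.2)) (by fun_prop)

/-- Convolution is positive and linear, so the setwise bounds c₁μ ≤ hμ ≤ c₂μ survive it with the
same constants. -/
lemma exists_density_gaussConv {μ : Measure E} [IsFiniteMeasure μ] (σ : ℝ) {h : E → ℝ}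
    (hm : Measurable h) {c₁ c₂ : ℝ} (hc₁ : 0 ≤ c₁) (hb₁ : ∀ x, c₁ ≤ h x) (hb₂ : ∀ x, h x ≤ c₂) :
    ∃ h' : E → ℝ, Measurable h' ∧ (∀ x, c₁ ≤ h' x) ∧ (∀ x, h' x ≤ c₂) ∧
      gaussConv σ (μ.withDensity fun x => ENNReal.ofReal (h x))
        = (gaussConv σ μ).withDensity fun x => ENNReal.ofReal (h' x) := by
  have : IsFiniteMeasure (μ.withDensity fun x => ENNReal.ofReal (h x)) :=
    isFiniteMeasure_withDensity_ofReal (integrable_of_abs_le hm (B := c₂) fun x => by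
      rw [abs_of_nonneg (hc₁.trans (hb₁ x))]; exact hb₂ x).2
  refine exists_bounded_density hc₁ ((hb₁ 0).trans (hb₂ 0)) (fun s hs => ?_) fun s hs => ?_
  all_goals
    have hmF := measurable_lintegral_comp_add_smul σ
      (F := s.indicator 1) (measurable_one.indicator hs)
    rw [gaussConv_apply σ _ hs, gaussConv_apply σ _ hs,
      lintegral_withDensity_eq_lintegral_mul _ (by fun_prop) hmF, ← lintegral_const_mul _ hmF]
    refine lintegral_mono fun x => ?_
    simp only [Pi.mul_apply]
    gcongr
  · exact hb₁ x
  · exact hb₂ x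

lemma gaussConv_gaussConv (a b : ℝ) (μ : Measure E) [IsFiniteMeasure μ] :
    gaussConv a (gaussConv b μ) = gaussConv (Real.sqrt (b ^ 2 + a ^ 2)) μ := by
  have hc : CompleteSpace E := FiniteDimensional.complete ℝ E
  unfold gaussConv
  rw [Measure.conv_assoc]
  congr 1
  refine Measure.ext_of_charFun ?_
  ext t
  rw [charFun_conv, charFun_map_smul, charFun_map_smul, charFun_map_smul, charFun_stdGaussian,
    charFun_stdGaussian, charFun_stdGaussian, ← Complex.exp_add]
  congr 1
  simp only [norm_smul, Real.norm_eq_abs]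
  norm_cast
  rw [mul_pow, mul_pow, mul_pow, sq_abs, sq_abs, sq_abs, Real.sq_sqrt (by positivity)]
  ring

lemma gaussConv_zero (μ : Measure E) [IsFiniteMeasure μ] : gaussConv 0 μ = μ := by
  unfold gaussConv
  simp only [zero_smul]
  rw [Measure.map_const]
  simp

lemma gaussConv_iterate (σ : ℝ) (μ : Measure E) [IsFiniteMeasure μ] (i : ℕ) :
    (gaussConv σ)^[i] μ = gaussConv (Real.sqrt (i * σ ^ 2)) μ := by
  induction i with
  | zero => simp [gaussConv_zero]
  | succ i ih =>
    rw [Function.iterate_succ_apply', ih, gaussConv_gaussConv, Real.sq_sqrt (by positivity)]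
    congr 2
    push_cast
    ring

lemma PoincareC1.iterate_gaussConv {μ : Measure E} [IsProbabilityMeasure μ] {C : ℝ} (hC : 0 ≤ C)
    (h : PoincareC1 μ C) (σ : ℝ) (i : ℕ) :
    IsProbabilityMeasure ((_root_.gaussConv σ)^[i] μ) ∧
    PoincareC1 ((_root_.gaussConv σ)^[i] μ) (C + i * (σ ^ 2 * (Real.pi ^ 2 / 8))) := by
  induction i with
  | zero => simpa using ⟨inferInstance, h⟩
  | succ i ih =>
    obtain ⟨hp, hi⟩ := ih
    rw [Function.iterate_succ_apply']
    refine ⟨inferInstance, ?_⟩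
    have := hi.gaussConv (by positivity) σ
    convert this using 1
    push_cast
    ring

/-- The Poincaré constants only grow along the iteration, so the smallness condition on σ²/C needs
checking at the start alone, while the j-th decrement carries the degraded constant. -/
lemma renyi_gaussConv_iterate {μ : Measure E} [IsProbabilityMeasure μ] {C : ℝ} (hC : 0 < C)
    (hP : PoincareC1 μ C) {σ : ℝ} (hσ : σ ≠ 0) (hσC : σ ^ 2 / C ≤ 1 / 5000) {p : ℝ} (hp : 2 < p)
    {h : E → ℝ} (hm : Measurable h) {c₁ c₂ : ℝ} (hc₁ : 0 < c₁)
    (hb₁ : ∀ x, c₁ ≤ h x) (hb₂ : ∀ x, h x ≤ c₂) (h1 : ∫ x, h x ∂μ = 1) {θ : ℝ}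
    (hθ : Real.log (∫ x, h x ^ p ∂μ) / (p - 1) ≤ linExp θ) (i : ℕ) :
    ∃ h' : E → ℝ, Measurable h' ∧ (∀ x, c₁ ≤ h' x) ∧ (∀ x, h' x ≤ c₂) ∧
      (gaussConv σ)^[i] (μ.withDensity fun x => ENNReal.ofReal (h x))
        = ((gaussConv σ)^[i] μ).withDensity (fun x => ENNReal.ofReal (h' x)) ∧
      ∫ x, h' x ∂((gaussConv σ)^[i] μ) = 1 ∧
      Real.log (∫ x, h' x ^ p ∂((gaussConv σ)^[i] μ)) / (p - 1)
        ≤ linExp (θ - ∑ j ∈ Finset.range i,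
          5 / 6 * (σ ^ 2 / (C + j * (σ ^ 2 * (Real.pi ^ 2 / 8))) / p)) := by
  induction i with
  | zero => exact ⟨h, hm, hb₁, hb₂, rfl, h1, by simpa using hθ⟩
  | succ i ih =>
    obtain ⟨h', hm', hb₁', hb₂', hρ, h1', hR⟩ := ih
    obtain ⟨hpr, hPi⟩ := hP.iterate_gaussConv hC.le σ i
    set μi := (gaussConv σ)^[i] μ
    obtain ⟨h'', hm'', hb₁'', hb₂'', hρ'⟩ :=
      exists_density_gaussConv (μ := μi) σ hm' hc₁.le hb₁' hb₂'
    have hCi : 0 < C + i * (σ ^ 2 * (Real.pi ^ 2 / 8)) := by positivity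
    have hle : σ ^ 2 / (C + i * (σ ^ 2 * (Real.pi ^ 2 / 8))) ≤ σ ^ 2 / C := by
      gcongr
      have : 0 ≤ (i : ℝ) * (σ ^ 2 * (Real.pi ^ 2 / 8)) := by positivity
      linarith
    obtain ⟨k1, k2⟩ := renyi_gaussConv_small_step hCi hPi hσ (hle.trans hσC) hp hm' hm'' hc₁
      hb₁' hb₂' hb₁'' hb₂'' h1' hρ' rfl rfl
    refine ⟨h'', hm'', hb₁'', hb₂'', ?_, ?_, ?_⟩
    · rw [Function.iterate_succ_apply', hρ, hρ', Function.iterate_succ_apply']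
    · rw [Function.iterate_succ_apply']; exact k1
    · rw [Function.iterate_succ_apply', Finset.sum_range_succ, ← sub_sub]
      exact le_linExp_sub (by positivity) k2 hR

/-- Relative to 1/β, the Poincaré constant at step j is c ≤ 1 + 1.234·j/N, by 2βε ≤ 1 and π²/8 ≤
1.234. The average of 1/c is at least 3/5, which offsets the factor (5/6)·2 = 5/3 exactly. -/
lemma sum_step_ge {β ε p : ℝ} (hβ : 0 < β) (hε : 0 < ε) (hβε : 2 * β * ε ≤ 1) (hp : 0 < p)
    {N : ℕ} (hN : 0 < N) :
    β * ε / p ≤ ∑ j ∈ Finset.range N, 5 / 6 * ((2 * ε / N)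
      / (1 / β + j * ((2 * ε / N) * (Real.pi ^ 2 / 8))) / p) := by
  have hN0 : (0 : ℝ) < N := by exact_mod_cast hN
  have hpi : Real.pi ^ 2 / 8 ≤ 1.234 := by
    have := Real.pi_lt_d4
    have := Real.pi_pos
    nlinarith
  set a := Real.pi ^ 2 / 8 with ha
  have ha0 : 0 < a := by positivity
  have hterm : ∀ j ∈ Finset.range N, 5 / 3 * (β * ε / p) / N * (6 / 5 - 9 / 25
        * (1 + j * (1.234 / N)))
      ≤ 5 / 6 * ((2 * ε / N) / (1 / β + j * ((2 * ε / N) * a)) / p) := by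
    intro j _
    set c := 1 + j * ((2 * β * ε) * a / N) with hc
    have hc0 : 0 < c := by positivity
    have hcl : c ≤ 1 + j * (1.234 / N) := by
      rw [hc]
      gcongr
      nlinarith
    have e : 5 / 6 * ((2 * ε / N) / (1 / β + j * ((2 * ε / N) * a)) / p)
        = 5 / 3 * (β * ε / p) / N * (1 / c) := by
      have : 1 / β + j * ((2 * ε / N) * a) = c / β := by rw [hc]; field_simp
      rw [this]; field_simp; ring
    rw [e]
    refine mul_le_mul_of_nonneg_left ?_ (by positivity)
    rw [le_div_iff₀ hc0]
    -- The tangent line of 1/c at c = 5/3, namely 6/5 - (9/25)c, lies below 1/c.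
    nlinarith [sq_nonneg (c - 5 / 3)]
  refine le_trans ?_ (Finset.sum_le_sum hterm)
  rw [← Finset.mul_sum]
  have hs : ∑ j ∈ Finset.range N, (6 / 5 - 9 / 25 * (1 + (j : ℝ) * (1.234 / N)))
      = N * (6 / 5 - 9 / 25) - 9 / 25 * (1.234 / N) * ∑ j ∈ Finset.range N, (j : ℝ) := by
    have : ∀ j ∈ Finset.range N, (6 / 5 - 9 / 25 * (1 + (j : ℝ) * (1.234 / N)))
        = (6 / 5 - 9 / 25) - 9 / 25 * (1.234 / N) * j := fun j _ => by ring
    rw [Finset.sum_congr rfl this, Finset.sum_sub_distrib, ← Finset.mul_sum]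
    simp
    ring
  have hg : ∑ j ∈ Finset.range N, (j : ℝ) ≤ N * N / 2 := by
    have := Finset.sum_range_id_mul_two N
    have h2 : (∑ j ∈ Finset.range N, (j : ℝ)) * 2 = N * (N - 1 : ℕ) := by
      rw [← Nat.cast_sum]; exact_mod_cast this
    have h3 : ((N - 1 : ℕ) : ℝ) ≤ N := by exact_mod_cast Nat.sub_le N 1
    nlinarith
  have hs2 : 3 / 5 * (N : ℝ)
      ≤ ∑ j ∈ Finset.range N, (6 / 5 - 9 / 25 * (1 + (j : ℝ) * (1.234 / N))) := by
    rw [hs]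
    have h4 : 9 / 25 * (1.234 / N) * ∑ j ∈ Finset.range N, (j : ℝ)
        ≤ 9 / 25 * (1.234 / N) * (N * N / 2) := by gcongr
    have h5 : 9 / 25 * (1.234 / N) * ((N : ℝ) * N / 2) = 9 / 25 * 1.234 / 2 * N := by field_simp
    rw [h5] at h4
    nlinarith
  calc β * ε / p = 5 / 3 * (β * ε / p) / N * (3 / 5 * N) := by field_simp
    _ ≤ _ := by gcongr

/-- Decrease of the Rényi divergence of order `p` along a Gaussian convolution of variance `2 ε`,
for bounded densities. -/
lemma renyi_gaussConv_bounded {μ : Measure E} [IsProbabilityMeasure μ] {β ε : ℝ} (hβ : 0 < β)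
    (hε : 0 < ε) (hβε : 2 * β * ε ≤ 1) (hP : PoincareC1 μ (1 / β)) {p : ℝ} (hp : 2 < p)
    {h : E → ℝ} (hm : Measurable h) {c₁ c₂ : ℝ} (hc₁ : 0 < c₁)
    (hb₁ : ∀ x, c₁ ≤ h x) (hb₂ : ∀ x, h x ≤ c₂) (h1 : ∫ x, h x ∂μ = 1) {θ : ℝ}
    (hθ : Real.log (∫ x, h x ^ p ∂μ) / (p - 1) ≤ linExp θ) :
    ∃ h' : E → ℝ, Measurable h' ∧ (∀ x, c₁ ≤ h' x) ∧ (∀ x, h' x ≤ c₂) ∧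
      gaussConv (Real.sqrt (2 * ε)) (μ.withDensity fun x => ENNReal.ofReal (h x))
        = (gaussConv (Real.sqrt (2 * ε)) μ).withDensity (fun x => ENNReal.ofReal (h' x)) ∧
      ∫ x, h' x ^ p ∂(gaussConv (Real.sqrt (2 * ε)) μ)
        ≤ Real.exp ((p - 1) * linExp (θ - β * ε / p)) := by
  have : IsFiniteMeasure (μ.withDensity fun x => ENNReal.ofReal (h x)) :=
    isFiniteMeasure_withDensity_ofReal (integrable_of_abs_le hm (B := c₂) fun x => by
      rw [abs_of_nonneg (hc₁.le.trans (hb₁ x))]; exact hb₂ x).2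
  -- With 2βε ≤ 1, each substep has σ²/C = 2βε/N ≤ 1/5000, the size required by the small step.
  set N : ℕ := 5000 with hN
  have hN0 : (0 : ℝ) < N := by norm_num [hN]
  set σ := Real.sqrt (2 * ε / N) with hσ
  have hσ2 : σ ^ 2 = 2 * ε / N := Real.sq_sqrt (by positivity)
  have hσ0 : σ ≠ 0 := (Real.sqrt_pos.2 (by positivity)).ne'
  have hσC : σ ^ 2 / (1 / β) ≤ 1 / 5000 := by
    rw [hσ2, hN]; push_cast; rw [div_div_eq_mul_div, div_one]; linarith
  obtain ⟨h', hm', hb₁', hb₂', hρ, h1', hR⟩ := renyi_gaussConv_iterate (by positivity) hP hσ0 hσC hp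
    hm hc₁ hb₁ hb₂ h1 hθ N
  have hit : (N : ℝ) * σ ^ 2 = 2 * ε := by rw [hσ2]; field_simp
  rw [gaussConv_iterate, gaussConv_iterate, hit] at hρ
  rw [gaussConv_iterate, hit] at hR
  refine ⟨h', hm', hb₁', hb₂', hρ, ?_⟩
  have hp1 : 0 < p - 1 := by linarith
  have hs := sum_step_ge (p := p) hβ hε hβε (by linarith) (N := N) (by norm_num [hN])
  rw [← hσ2] at hs
  have hR2 := hR.trans (linExp_strictMono.monotone (sub_le_sub_left hs θ))
  rw [div_le_iff₀ hp1] at hR2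
  rcases le_or_gt (∫ x, h' x ^ p ∂(gaussConv (Real.sqrt (2 * ε)) μ)) 0 with h0 | h0
  · exact h0.trans (Real.exp_pos _).le
  · rw [← Real.log_le_iff_le_exp h0]
    linarith

end Iteration

/-! ### Removing the bounds on the density. -/

section GeneralDensity

/-- Testing with F = min(H, k)^(p-1) gives T ≤ B^(1/p) T^(1/r) for the truncated p-th moment T,
hence T ≤ B; then let k grow. Bounded test functions thus suffice, and finiteness of the moment is a
conclusion. -/
lemma lintegral_rnDeriv_rpow_le_of_dual {α : Type*} [MeasurableSpace α] {μ ρ : Measure α}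
    [IsFiniteMeasure μ] [IsFiniteMeasure ρ] (hac : ρ ≪ μ) {p r B : ℝ} (hpr : p.HolderConjugate r)
    (hB : 0 ≤ B)
    (h : ∀ (F : α → ℝ) (b : ℝ), Measurable F → (∀ x, 0 ≤ F x) → (∀ x, F x ≤ b) →
      ∫ x, F x ∂ρ ≤ B ^ (1 / p) * (∫ x, F x ^ r ∂μ) ^ (1 / r)) :
    ∫⁻ x, (ρ.rnDeriv μ x) ^ p ∂μ ≤ ENNReal.ofReal B := by
  have hp : 1 < p := hpr.lt
  have hp0 : 0 < p := hpr.pos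
  have hmD := Measure.measurable_rnDeriv ρ μ
  set H : α → ℝ := fun x => (ρ.rnDeriv μ x).toReal with hH
  have hHm : Measurable H := hmD.ennreal_toReal
  have hH0 : ∀ x, 0 ≤ H x := fun x => ENNReal.toReal_nonneg
  have hHi : Integrable H μ := Measure.integrable_toReal_rnDeriv
  have hk0 : ∀ (k : ℕ) x, 0 ≤ min (H x) k := fun k x => le_min (hH0 x) k.cast_nonneg
  have hkey : ∀ k : ℕ, ∫ x, min (H x) k ^ p ∂μ ≤ B := by
    intro k
    set F : α → ℝ := fun x => min (H x) k ^ (p - 1) with hF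
    have hFm : Measurable F := (hHm.min measurable_const).pow_const _
    have hF0 : ∀ x, 0 ≤ F x := fun x => Real.rpow_nonneg (hk0 k x) _
    have hFb : ∀ x, F x ≤ (k : ℝ) ^ (p - 1) := fun x =>
      Real.rpow_le_rpow (hk0 k x) (min_le_right _ _) (by linarith)
    have h1 := h F _ hFm hF0 hFb
    have hFr : ∀ x, F x ^ r = min (H x) k ^ p := fun x => by
      rw [hF, ← Real.rpow_mul (hk0 k x)]; congr 1
      have := hpr.sub_one_mul_conj; linarith
    simp_rw [hFr] at h1
    have h2 : ∫ x, F x ∂ρ = ∫ x, H x * F x ∂μ := by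
      have := integral_rnDeriv_smul (f := F) hac
      simpa only [smul_eq_mul] using this.symm
    have h3 : ∀ x, min (H x) k ^ p ≤ H x * F x := fun x => by
      have : min (H x) k ^ p = min (H x) k * F x := by
        rcases (hk0 k x).eq_or_lt with h0 | h0
        · rw [← h0, Real.zero_rpow hp0.ne', zero_mul]
        · rw [hF, mul_comm, ← Real.rpow_add_one h0.ne']; congr 1; ring
      rw [this]
      exact mul_le_mul_of_nonneg_right (min_le_left _ _) (hF0 x)
    have h4 : Integrable (fun x => H x * F x) μ :=
      hHi.mul_bdd (c := (k : ℝ) ^ (p - 1)) hFm.aestronglyMeasurable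
        (.of_forall fun x => by rw [Real.norm_eq_abs, abs_of_nonneg (hF0 x)]; exact hFb x)
    set T := ∫ x, min (H x) k ^ p ∂μ with hT
    have hT0 : 0 ≤ T := integral_nonneg fun x => Real.rpow_nonneg (hk0 k x) _
    have h5 : T ≤ B ^ (1 / p) * T ^ (1 / r) := by
      refine le_trans ?_ (h2 ▸ h1)
      exact integral_mono_of_nonneg (.of_forall fun x => Real.rpow_nonneg (hk0 k x) _) h4
        (.of_forall h3)
    rcases hT0.eq_or_lt with h0 | h0
    · rw [← h0]; exact hB
    · have hTr : 0 < T ^ (1 / r) := Real.rpow_pos_of_pos h0 _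
      have h6 : T ^ (1 / p) ≤ B ^ (1 / p) := by
        have e : T = T ^ (1 / p) * T ^ (1 / r) := by
          rw [← Real.rpow_add h0]
          have := hpr.inv_add_inv_eq_one
          rw [one_div, one_div, this, Real.rpow_one]
        exact le_of_mul_le_mul_right (e.symm.le.trans h5) hTr
      exact (Real.rpow_le_rpow_iff hT0 hB (by positivity)).1 h6
  have hmono := lintegral_tendsto_of_tendsto_of_monotone (μ := μ)
    (f := fun (k : ℕ) x => ENNReal.ofReal (min (H x) k ^ p)) (F := fun x => ENNReal.ofReal (H x ^ p))
    (fun k => (((hHm.min measurable_const).pow_const p).ennreal_ofReal).aemeasurable)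
    (.of_forall fun x i j hij => ENNReal.ofReal_le_ofReal
      (Real.rpow_le_rpow (hk0 i x) (min_le_min_left _ (by exact_mod_cast hij)) hp0.le))
    (.of_forall fun x => by
      refine tendsto_const_nhds.congr' ?_
      obtain ⟨m, hm⟩ := exists_nat_ge (H x)
      filter_upwards [eventually_ge_atTop m] with k hk
      rw [min_eq_left (hm.trans (by exact_mod_cast hk))])
  have heq : ∫⁻ x, (ρ.rnDeriv μ x) ^ p ∂μ = ∫⁻ x, ENNReal.ofReal (H x ^ p) ∂μ := by
    refine lintegral_congr_ae ?_
    filter_upwards [ρ.rnDeriv_lt_top μ] with x hx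
    rw [hH, ← ENNReal.ofReal_rpow_of_nonneg ENNReal.toReal_nonneg hp0.le,
      ENNReal.ofReal_toReal hx.ne]
  rw [heq]
  refine le_of_tendsto' hmono fun k => ?_
  rw [← ofReal_integral_eq_lintegral_ofReal]
  · exact ENNReal.ofReal_le_ofReal (hkey k)
  · exact Integrable.of_bound ((hHm.min measurable_const).pow_const p).aestronglyMeasurable
      ((k : ℝ) ^ p) (.of_forall fun x => by
        rw [Real.norm_eq_abs, abs_of_nonneg (Real.rpow_nonneg (hk0 k x) _)]
        exact Real.rpow_le_rpow (hk0 k x) (min_le_right _ _) hp0.le)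
  · exact .of_forall fun x => Real.rpow_nonneg (hk0 k x) _

variable {E : Type*} [NormedAddCommGroup E] [InnerProductSpace ℝ E] [FiniteDimensional ℝ E]
  [MeasurableSpace E] [BorelSpace E]

lemma gaussConv_absolutelyContinuous {ρ μ : Measure E} (h : ρ ≪ μ) (σ : ℝ) :
    gaussConv σ ρ ≪ gaussConv σ μ := by
  refine Measure.AbsolutelyContinuous.mk fun s hs h0 => ?_
  have hmF := measurable_lintegral_comp_add_smul σ
    (F := s.indicator 1) (measurable_one.indicator hs)
  rw [gaussConv_apply σ _ hs, lintegral_eq_zero_iff hmF] at h0 ⊢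
  exact h.ae_le h0

/-- Decrease of the Rényi divergence of order `p` along a Gaussian convolution of variance `2 ε`. -/
lemma renyi_gaussConv {μ ρ : Measure E} [IsProbabilityMeasure μ] [IsProbabilityMeasure ρ]
    {β ε : ℝ} (hβ : 0 < β) (hε : 0 < ε) (hβε : 2 * β * ε ≤ 1) (hP : PoincareC1 μ (1 / β)) {p : ℝ}
    (hp : 2 < p) (hac : ρ ≪ μ) {θ : ℝ}
    (hV : ∫⁻ x, (ρ.rnDeriv μ x) ^ p ∂μ ≤ ENNReal.ofReal (Real.exp ((p - 1) * linExp θ))) :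
    ∫⁻ x, ((gaussConv (Real.sqrt (2 * ε)) ρ).rnDeriv (gaussConv (Real.sqrt (2 * ε)) μ) x) ^ p
        ∂(gaussConv (Real.sqrt (2 * ε)) μ)
      ≤ ENNReal.ofReal (Real.exp ((p - 1) * linExp (θ - β * ε / p))) := by
  have hp0 : 0 < p := by linarith
  have hp1 : 0 < p - 1 := by linarith
  have hpr : p.HolderConjugate (Real.conjExponent p) := .conjExponent (by linarith)
  set r := Real.conjExponent p
  have hr0 : 0 < r := hpr.symm.pos
  set s := Real.sqrt (2 * ε)
  refine lintegral_rnDeriv_rpow_le_of_dual (gaussConv_absolutelyContinuous hac s) hpr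
    (Real.exp_pos _).le fun F b hFm hF0 hFb => ?_
  have hFab : ∀ x, |F x| ≤ b := fun x => by rw [abs_of_nonneg (hF0 x)]; exact hFb x
  have hmD := Measure.measurable_rnDeriv ρ μ
  set H : E → ℝ := fun x => (ρ.rnDeriv μ x).toReal with hH
  have hHm : Measurable H := hmD.ennreal_toReal
  have hH0 : ∀ x, 0 ≤ H x := fun x => ENNReal.toReal_nonneg
  have hHi : Integrable H μ := Measure.integrable_toReal_rnDeriv
  have hH1 : ∫ x, H x ∂μ = 1 := by
    rw [Measure.integral_toReal_rnDeriv hac]; simp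
  have heq : ∫⁻ x, (ρ.rnDeriv μ x) ^ p ∂μ = ∫⁻ x, ENNReal.ofReal (H x ^ p) ∂μ := by
    refine lintegral_congr_ae ?_
    filter_upwards [ρ.rnDeriv_lt_top μ] with x hx
    rw [hH, ← ENNReal.ofReal_rpow_of_nonneg ENNReal.toReal_nonneg hp0.le,
      ENNReal.ofReal_toReal hx.ne]
  rw [heq] at hV
  have hHp0 : ∀ x, 0 ≤ H x ^ p := fun x => Real.rpow_nonneg (hH0 x) p
  have hHpi : Integrable (fun x => H x ^ p) μ := by
    refine ⟨(hHm.pow_const p).aestronglyMeasurable, ?_⟩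
    rw [hasFiniteIntegral_iff_ofReal (.of_forall hHp0)]
    exact hV.trans_lt ENNReal.ofReal_lt_top
  rw [← ofReal_integral_eq_lintegral_ofReal hHpi (.of_forall hHp0),
    ENNReal.ofReal_le_ofReal_iff (Real.exp_pos _).le] at hV
  have hV1 := one_le_integral_rpow (by linarith) hH0 hHi hHpi hH1
  set V := ∫ x, H x ^ p ∂μ with hVdef
  have hR : Real.log V / (p - 1) ≤ linExp θ := by
    rw [div_le_iff₀ hp1, Real.log_le_iff_le_exp (by linarith), mul_comm]; exact hV
  -- Truncation above and a vanishing positive floor, normalised below by the mass Z j, to enter the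
  -- range of the bounded result.
  let k : ℕ → E → ℝ := fun j x => min (H x) j + 1 / (j + 1)
  have hk1 : ∀ (j : ℕ) x, 1 / ((j : ℝ) + 1) ≤ k j x := fun j x => by
    have : 0 ≤ min (H x) j := le_min (hH0 x) j.cast_nonneg
    simp only [k]; linarith
  have hj0 : ∀ j : ℕ, (0 : ℝ) < 1 / ((j : ℝ) + 1) := fun j => by positivity
  have hj1 : ∀ j : ℕ, 1 / ((j : ℝ) + 1) ≤ 1 := fun j => by
    rw [div_le_one (by positivity)]; linarith [j.cast_nonneg (α := ℝ)]
  have hk0 : ∀ j x, 0 < k j x := fun j x => (hj0 j).trans_le (hk1 j x)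
  have hk2 : ∀ (j : ℕ) x, k j x ≤ j + 1 := fun j x => add_le_add (min_le_right _ _) (hj1 j)
  have hkH : ∀ j x, k j x ≤ H x + 1 := fun j x => add_le_add (min_le_left _ _) (hj1 j)
  have hkm : ∀ j, Measurable (k j) := fun j => (hHm.min measurable_const).add_const _
  have hkab : ∀ (j : ℕ) x, |k j x| ≤ j + 1 := fun j x => by
    rw [abs_of_pos (hk0 j x)]; exact hk2 j x
  have hklim : ∀ x, Tendsto (fun j => k j x) atTop (𝓝 (H x)) := fun x => by
    have h1 : Tendsto (fun j : ℕ => min (H x) j) atTop (𝓝 (H x)) := by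
      refine tendsto_const_nhds.congr' ?_
      obtain ⟨m, hm⟩ := exists_nat_ge (H x)
      filter_upwards [eventually_ge_atTop m] with j hj
      rw [min_eq_left (hm.trans (by exact_mod_cast hj))]
    have h2 := h1.add (tendsto_one_div_add_atTop_nhds_zero_nat (𝕜 := ℝ))
    rw [add_zero] at h2
    exact h2
  have hHi1 : Integrable (fun x => H x + 1) μ := hHi.add (integrable_const 1)
  set Z : ℕ → ℝ := fun j => ∫ x, k j x ∂μ with hZ
  have hZ1 : Tendsto Z atTop (𝓝 1) := by
    rw [← hH1]
    exact tendsto_integral_of_dominated_convergence (fun x => H x + 1)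
      (fun j => (hkm j).aestronglyMeasurable) hHi1
      (fun j => .of_forall fun x => by
        rw [Real.norm_eq_abs, abs_of_pos (hk0 j x)]; exact hkH j x) (.of_forall hklim)
  have hZ0 : ∀ j, 0 < Z j := fun j => by
    have := integral_mono (integrable_const (1 / ((j : ℝ) + 1)))
      (integrable_of_abs_le (μ := μ) (hkm j) (hkab j)) (hk1 j)
    simp only [integral_const, probReal_univ, one_smul] at this
    exact (hj0 j).trans_le this
  have hkp : Tendsto (fun j => ∫ x, k j x ^ p ∂μ) atTop (𝓝 V) := by
    refine tendsto_integral_of_dominated_convergence (fun x => 2 ^ p * (H x ^ p + 1))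
      (fun j => ((hkm j).pow_const p).aestronglyMeasurable)
      ((hHpi.add (integrable_const 1)).const_mul _) (fun j => .of_forall fun x => ?_)
      (.of_forall fun x => (hklim x).rpow_const (Or.inr hp0.le))
    rw [Real.norm_eq_abs, abs_of_pos (Real.rpow_pos_of_pos (hk0 j x) p)]
    have h1 : k j x ≤ 2 * max (H x) 1 := by
      have := hkH j x
      have := le_max_left (H x) 1
      have := le_max_right (H x) 1
      linarith
    calc k j x ^ p ≤ (2 * max (H x) 1) ^ p := Real.rpow_le_rpow (hk0 j x).le h1 hp0.le
      _ = 2 ^ p * max (H x) 1 ^ p := Real.mul_rpow (by norm_num) (by positivity)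
      _ ≤ 2 ^ p * (H x ^ p + 1) := by
        gcongr
        rcases max_cases (H x) 1 with ⟨h, _⟩ | ⟨h, _⟩
        · rw [h]; linarith
        · rw [h, Real.one_rpow]; linarith [hHp0 x]
  let h : ℕ → E → ℝ := fun j x => k j x / Z j
  have hhm : ∀ j, Measurable (h j) := fun j => (hkm j).div_const _
  have hh1 : ∀ j, ∫ x, h j x ∂μ = 1 := fun j => by
    simp only [h]
    rw [integral_div]
    exact div_self (hZ0 j).ne'
  have hhp : ∀ j, ∫ x, h j x ^ p ∂μ = (∫ x, k j x ^ p ∂μ) / Z j ^ p := fun j => by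
    rw [← integral_div]
    refine integral_congr_ae (.of_forall fun x => ?_)
    simp only [h]
    rw [Real.div_rpow (hk0 j x).le (hZ0 j).le]
  have hVlim : Tendsto (fun j => ∫ x, h j x ^ p ∂μ) atTop (𝓝 V) := by
    simp_rw [hhp]
    have h2 := hkp.div (hZ1.rpow_const (p := p) (Or.inr hp0.le)) (by simp)
    rw [Real.one_rpow, div_one] at h2
    exact h2
  have hRlim : Tendsto (fun j => Real.log (∫ x, h j x ^ p ∂μ) / (p - 1)) atTop
      (𝓝 (Real.log V / (p - 1))) :=
    (hVlim.log (by linarith)).div_const _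
  set μ' := gaussConv s μ with hμ'
  have hF' : ∫ x, F x ∂(gaussConv s ρ) = ∫ x, H x * gaussSmooth s F x ∂μ := by
    rw [integral_gaussConv s ρ hFm hFab]
    have := integral_rnDeriv_smul (f := gaussSmooth s F) hac
    simpa only [smul_eq_mul] using this.symm
  have hSb := abs_gaussSmooth_le s hFab
  have hSm := measurable_gaussSmooth s hFm
  have hlim : Tendsto (fun j => ∫ x, h j x * gaussSmooth s F x ∂μ) atTop
      (𝓝 (∫ x, F x ∂(gaussConv s ρ))) := by
    have h1 : Tendsto (fun j => ∫ x, k j x * gaussSmooth s F x ∂μ) atTop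
        (𝓝 (∫ x, H x * gaussSmooth s F x ∂μ)) := by
      refine tendsto_integral_of_dominated_convergence (fun x => (H x + 1) * b)
        (fun j => ((hkm j).mul hSm).aestronglyMeasurable) (hHi1.mul_const _)
        (fun j => .of_forall fun x => ?_) (.of_forall fun x => (hklim x).mul_const _)
      rw [norm_mul, Real.norm_eq_abs, Real.norm_eq_abs, abs_of_pos (hk0 j x)]
      exact mul_le_mul (hkH j x) (hSb x) (abs_nonneg _) (by linarith [hH0 x])
    have h2 := h1.div hZ1 one_ne_zero
    rw [hF']
    rw [div_one] at h2
    refine h2.congr fun j => ?_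
    simp only [Pi.div_apply]
    rw [← integral_div]
    refine integral_congr_ae (.of_forall fun x => ?_)
    simp only [h]
    ring
  -- The divergences of the approximants converge but may exceed linExp θ; the slack δ admits them
  -- eventually and is then sent to 0 by continuity. Only pairings with F pass to the limit, so
  -- convergence of the convolved densities is never needed.
  have hδ : ∀ δ : ℝ, 0 < δ → ∫ x, F x ∂(gaussConv s ρ)
      ≤ Real.exp ((p - 1) * linExp (θ + δ - β * ε / p)) ^ (1 / p)
        * (∫ x, F x ^ r ∂μ') ^ (1 / r) := by
    intro δ hδ
    have hlt : Real.log V / (p - 1) < linExp (θ + δ) :=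
      hR.trans_lt (linExp_strictMono (by linarith))
    refine le_of_tendsto hlim ?_
    filter_upwards [hRlim.eventually (gt_mem_nhds hlt)] with j hj
    have hc1 : 0 < 1 / ((j : ℝ) + 1) / Z j := div_pos (hj0 j) (hZ0 j)
    have hb1 : ∀ x, 1 / ((j : ℝ) + 1) / Z j ≤ h j x := fun x =>
      div_le_div_of_nonneg_right (hk1 j x) (hZ0 j).le
    have hb2 : ∀ x, h j x ≤ ((j : ℝ) + 1) / Z j := fun x =>
      div_le_div_of_nonneg_right (hk2 j x) (hZ0 j).le
    obtain ⟨h', hm', hb1', hb2', hρ, hbound⟩ := renyi_gaussConv_bounded hβ hε hβε hP hp (hhm j)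
      hc1 hb1 hb2 (hh1 j) hj.le
    have hpos' : ∀ x, 0 ≤ h' x := fun x => hc1.le.trans (hb1' x)
    rw [← integral_mul_density_gaussConv (hhm j) hm' (B := ((j : ℝ) + 1) / Z j) (fun x => by
      rw [abs_of_nonneg (hc1.le.trans (hb1 x))]; exact hb2 x) (fun x => hc1.le.trans (hb1 x))
      hpos' hρ hFm hFab]
    have hhol := integral_mul_le_Lp_mul_Lq_of_nonneg (μ := μ') hpr
      (.of_forall hpos') (.of_forall hF0)
      (MemLp.of_bound hm'.aestronglyMeasurable (((j : ℝ) + 1) / Z j) (.of_forall fun x => by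
        rw [Real.norm_eq_abs, abs_of_nonneg (hpos' x)]; exact hb2' x))
      (MemLp.of_bound hFm.aestronglyMeasurable b (.of_forall hFab))
    refine hhol.trans ?_
    exact mul_le_mul_of_nonneg_right (Real.rpow_le_rpow
      (integral_nonneg fun x => Real.rpow_nonneg (hpos' x) _) hbound (by positivity))
      (Real.rpow_nonneg (integral_nonneg fun x => Real.rpow_nonneg (hF0 x) _) _)
  have hcont : Tendsto (fun δ : ℝ => Real.exp ((p - 1) * linExp (θ + δ - β * ε / p)) ^ (1 / p)
        * (∫ x, F x ^ r ∂μ') ^ (1 / r)) (𝓝[>] 0)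
      (𝓝 (Real.exp ((p - 1) * linExp (θ + 0 - β * ε / p)) ^ (1 / p)
        * (∫ x, F x ^ r ∂μ') ^ (1 / r))) := by
    refine Tendsto.mono_left ?_ nhdsWithin_le_nhds
    have hc : Continuous fun δ : ℝ => Real.exp ((p - 1) * linExp (θ + δ - β * ε / p)) := by
      have := continuous_linExp
      fun_prop
    exact ((hc.tendsto 0).rpow_const (Or.inr (by positivity))).mul_const _
  rw [add_zero] at hcont
  exact ge_of_tendsto hcont (by filter_upwards [self_mem_nhdsWithin] with δ hd using hδ δ hd)

end GeneralDensity

/-! ### Invariance and weak triangle inequality for Rényi integrals. -/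

section Renyi

/-- The Rényi integral is invariant under measurable equivalences. -/
lemma lintegral_rnDeriv_rpow_map {α β : Type*} [MeasurableSpace α] [MeasurableSpace β]
    {g : α → β} (hg : MeasurableEmbedding g) (ρ μ : Measure α) [SigmaFinite ρ] [SigmaFinite μ]
    (p : ℝ) :
    ∫⁻ y, ((ρ.map g).rnDeriv (μ.map g) y) ^ p ∂(μ.map g) = ∫⁻ x, (ρ.rnDeriv μ x) ^ p ∂μ := by
  rw [hg.lintegral_map]
  refine lintegral_congr_ae ?_
  filter_upwards [hg.rnDeriv_map ρ μ] with x hx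
  rw [hx]

lemma lintegral_rnDeriv_rpow_le_of_trans {α : Type*} [MeasurableSpace α] {ρ μ ν : Measure α}
    [SigmaFinite ρ] [SigmaFinite μ] [SigmaFinite ν] (h₁ : ρ ≪ μ) (h₂ : μ ≪ ν) {q : ℝ}
    (hq : 1 < q) :
    ∫⁻ x, (ρ.rnDeriv ν x) ^ q ∂ν ≤ (∫⁻ x, (ρ.rnDeriv μ x) ^ (2 * q) ∂μ) ^ (1 / 2 : ℝ)
      * (∫⁻ x, (μ.rnDeriv ν x) ^ (2 * q - 1) ∂ν) ^ (1 / 2 : ℝ) := by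
  have hh := Measure.measurable_rnDeriv ρ μ
  have hw := Measure.measurable_rnDeriv μ ν
  -- By the chain rule for derivatives, (dμ/dν)^q is split as powers 1/2 and q - 1/2: squaring the
  -- first factor leaves one dμ/dν, which turns ν into μ, and squaring the second gives the order 2q
  -- - 1.
  have e : ∫⁻ x, (ρ.rnDeriv ν x) ^ q ∂ν
      = ∫⁻ x, ((fun x => (ρ.rnDeriv μ x) ^ q * (μ.rnDeriv ν x) ^ (1 / 2 : ℝ))
        * fun x => (μ.rnDeriv ν x) ^ (q - 1 / 2)) x ∂ν := by
    refine lintegral_congr_ae ?_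
    filter_upwards [Measure.rnDeriv_mul_rnDeriv (κ := ν) h₁] with x hx
    simp only [Pi.mul_apply] at hx ⊢
    rw [← hx, ENNReal.mul_rpow_of_nonneg _ _ (by linarith), mul_assoc,
      ← ENNReal.rpow_add_of_nonneg _ _ (by norm_num) (by linarith)]
    congr 2; ring
  have hH := ENNReal.lintegral_mul_le_Lp_mul_Lq ν Real.HolderConjugate.two_two
    (f := fun x => (ρ.rnDeriv μ x) ^ q * (μ.rnDeriv ν x) ^ (1 / 2 : ℝ))
    (g := fun x => (μ.rnDeriv ν x) ^ (q - 1 / 2))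
    ((hh.pow_const _).mul (hw.pow_const _)).aemeasurable (hw.pow_const _).aemeasurable
  rw [e]
  refine hH.trans_eq ?_
  congr 2
  · rw [← lintegral_rnDeriv_mul h₂ (hh.pow_const _).aemeasurable]
    refine lintegral_congr fun x => ?_
    rw [ENNReal.mul_rpow_of_nonneg _ _ (by norm_num), ← ENNReal.rpow_mul, ← ENNReal.rpow_mul,
      mul_comm]
    norm_num [mul_comm]
  · refine lintegral_congr fun x => ?_
    rw [← ENNReal.rpow_mul]
    congr 1; ring

/-- Weak triangle inequality for the Rényi divergence. -/
lemma renyiDiv_le_of_lintegral_le {α : Type*} [MeasurableSpace α] {ρ μ ν : Measure α}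
    [SigmaFinite ρ] [SigmaFinite μ] [SigmaFinite ν] (h₁ : ρ ≪ μ) {q c : ℝ} (hq : 1 < q)
    (hc : ∫⁻ x, (ρ.rnDeriv μ x) ^ (2 * q) ∂μ ≤ ENNReal.ofReal (Real.exp ((2 * q - 1) * c))) :
    renyiDiv q ρ ν ≤ (((q - 1 / 2) / (q - 1) * c : ℝ) : EReal) + renyiDiv (2 * q - 1) μ ν := by
  have hq1 : 0 < q - 1 := by linarith
  by_cases h₂ : μ ≪ ν
  swap
  · rw [renyiDiv, renyiDiv, if_neg h₂, EReal.coe_add_top]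
    exact le_top
  rw [renyiDiv, renyiDiv, if_pos h₂, if_pos (h₁.trans h₂)]
  have h0 : (0 : EReal) ≤ ((1 / (q - 1) : ℝ) : EReal) := by
    exact_mod_cast (one_div_pos.2 hq1).le
  have hlog : ENNReal.log (∫⁻ x, (ρ.rnDeriv ν x) ^ q ∂ν)
      ≤ ((1 / 2 * ((2 * q - 1) * c) : ℝ) : EReal)
        + ((1 / 2 : ℝ) : EReal) * ENNReal.log (∫⁻ x, (μ.rnDeriv ν x) ^ (2 * q - 1) ∂ν) := by
    refine (ENNReal.log_monotone (lintegral_rnDeriv_rpow_le_of_trans h₁ h₂ hq)).trans ?_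
    rw [ENNReal.log_mul_add, ENNReal.log_rpow, ENNReal.log_rpow]
    gcongr
    refine (mul_le_mul_of_nonneg_left (ENNReal.log_monotone hc) ?_).trans_eq ?_
    · exact_mod_cast (by norm_num : (0 : ℝ) ≤ 1 / 2)
    · rw [ENNReal.log_ofReal_of_pos (Real.exp_pos _), Real.log_exp, ← EReal.coe_mul]
  refine (mul_le_mul_of_nonneg_left hlog h0).trans_eq ?_
  rw [EReal.left_distrib_of_nonneg_of_ne_top h0 (EReal.coe_ne_top _), ← EReal.coe_mul,
    ← mul_assoc (((1 / (q - 1) : ℝ) : EReal)) (((1 / 2 : ℝ) : EReal)), ← EReal.coe_mul]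
  have e1 : 1 / (q - 1) * (1 / 2 * ((2 * q - 1) * c)) = (q - 1 / 2) / (q - 1) * c := by
    field_simp
  have e2 : 1 / (q - 1) * (1 / 2) = 1 / (2 * q - 1 - 1) := by
    rw [one_div_mul_one_div]
    congr 1
    ring
  rw [e1, e2]

/-- The starting point of the profile: R ≤ linExp (R - 1), with equality once R ≥ 1. This is the
origin of the -1 in k₀. -/
lemma exists_lintegral_le_of_renyiDiv_ne_top {α : Type*} [MeasurableSpace α] {ρ μ : Measure α}
    {p : ℝ} (hp : 1 < p) (h : renyiDiv p ρ μ ≠ ⊤) :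
    ρ ≪ μ ∧ ∫⁻ x, (ρ.rnDeriv μ x) ^ p ∂μ
      ≤ ENNReal.ofReal (Real.exp ((p - 1) * linExp ((renyiDiv p ρ μ).toReal - 1))) := by
  have hp1 : 0 < p - 1 := by linarith
  by_cases hac : ρ ≪ μ
  swap
  · exact absurd (by rw [renyiDiv, if_neg hac]) h
  refine ⟨hac, ?_⟩
  rw [renyiDiv, if_pos hac] at h ⊢
  set V := ∫⁻ x, (ρ.rnDeriv μ x) ^ p ∂μ
  have hV : V ≠ ⊤ := fun hV => h (by
    rw [hV, ENNReal.log_top, EReal.coe_mul_top_of_pos (one_div_pos.2 hp1)])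
  rcases eq_or_ne V 0 with h0 | h0
  · rw [h0]; exact zero_le
  rw [ENNReal.log_pos_real h0 hV, ← EReal.coe_mul, EReal.toReal_coe]
  set R := 1 / (p - 1) * Real.log V.toReal with hR
  have hlin : R ≤ linExp (R - 1) := by
    rcases le_total 0 (R - 1) with h | h
    · rw [linExp_of_nonneg h]; linarith
    · rw [linExp_of_nonpos h]; linarith [Real.add_one_le_exp (R - 1)]
  rw [← ENNReal.ofReal_toReal hV]
  refine ENNReal.ofReal_le_ofReal ?_
  rw [← Real.log_le_iff_le_exp (ENNReal.toReal_pos h0 hV)]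
  have : Real.log V.toReal = (p - 1) * R := by rw [hR]; field_simp
  rw [this]
  exact mul_le_mul_of_nonneg_left hlin hp1.le

end Renyi

/-! ### The algorithm as a Gaussian convolution followed by a homeomorphism. -/

section Laws

/-- A perturbation of the identity with Lipschitz constant εL < 1 is a global homeomorphism. -/
lemma exists_homeomorph_id_add_smul {E : Type*} [NormedAddCommGroup E] [InnerProductSpace ℝ E]
    [CompleteSpace E] {G : E → E} {L ε : ℝ} (hL : 0 ≤ L) (hε : 0 ≤ ε)
    (hG : ∀ x y, ‖G x - G y‖ ≤ L * ‖x - y‖) (hεL : ε * L < 1) :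
    ∃ e : E ≃ₜ E, ∀ x, e x = x + ε • G x := by
  have ha : ApproximatesLinearOn (fun x => x + ε • G x)
      ((ContinuousLinearEquiv.refl ℝ E : E ≃L[ℝ] E) : E →L[ℝ] E) Set.univ
      ⟨ε * L, mul_nonneg hε hL⟩ := by
    intro x _ y _
    have : x + ε • G x - (y + ε • G y) - ((ContinuousLinearEquiv.refl ℝ E : E ≃L[ℝ] E) :
        E →L[ℝ] E) (x - y) = ε • (G x - G y) := by
      simp only [ContinuousLinearEquiv.coe_refl, ContinuousLinearMap.coe_id', id_eq, smul_sub]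
      abel
    rw [this, norm_smul, Real.norm_of_nonneg hε]
    calc ε * ‖G x - G y‖ ≤ ε * (L * ‖x - y‖) := mul_le_mul_of_nonneg_left (hG x y) hε
      _ = ε * L * ‖x - y‖ := by ring
  have hc : Subsingleton E ∨ (⟨ε * L, mul_nonneg hε hL⟩ : NNReal)
      < ‖((ContinuousLinearEquiv.refl ℝ E).symm : E →L[ℝ] E)‖₊⁻¹ := by
    rcases subsingleton_or_nontrivial E with h | h
    · exact Or.inl h
    · right
      have : ‖((ContinuousLinearEquiv.refl ℝ E).symm : E →L[ℝ] E)‖₊ = 1 := by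
        rw [ContinuousLinearEquiv.refl_symm, ContinuousLinearEquiv.coe_refl]
        exact nnnorm_one
      rw [this, inv_one]
      exact hεL
  exact ⟨ha.toHomeomorph _ hc, fun x => rfl⟩

variable {E : Type*} [NormedAddCommGroup E] [InnerProductSpace ℝ E] [FiniteDimensional ℝ E]
  [MeasurableSpace E] [BorelSpace E]

/-- Gaussian smoothing preserves bounded continuous functions. -/
lemma continuous_gaussSmooth_of_continuous (σ : ℝ) {F : E → ℝ} (hF : Continuous F) {B : ℝ}
    (hB : ∀ x, |F x| ≤ B) : Continuous (gaussSmooth σ F) := by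
  refine continuous_of_dominated (bound := fun _ => B)
    (fun x => Continuous.aestronglyMeasurable (by fun_prop)) (fun x => .of_forall fun z => hB _)
    (integrable_const _) (.of_forall fun z => by fun_prop)

/-- A weak limit of the orbit of a law under the kernel `μ ↦ (μ * N(0, σ²)) ∘ e` is stationary. -/
lemma map_gaussConv_eq_of_tendsto (σ : ℝ) (e : E ≃ₜ E) {ρ : ℕ → ProbabilityMeasure E}
    {μ : ProbabilityMeasure E}
    (hρ : ∀ k, (ρ (k + 1) : Measure E) = (gaussConv σ (ρ k : Measure E)).map e)
    (hlim : Tendsto ρ atTop (𝓝 μ)) :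
    (gaussConv σ (μ : Measure E)).map e = μ := by
  have he : Measurable e := e.continuous.measurable
  have hmap : ∀ (κ : ProbabilityMeasure E) (φ : BoundedContinuousFunction E ℝ),
      ∫ x, φ x ∂((gaussConv σ (κ : Measure E)).map e)
        = ∫ x, gaussSmooth σ (fun y => φ (e y)) x ∂(κ : Measure E) := fun κ φ => by
    rw [integral_map he.aemeasurable φ.continuous.aestronglyMeasurable]
    exact integral_gaussConv σ _ (φ.continuous.comp e.continuous).measurable
      (fun x => φ.norm_coe_le_norm (e x))
  have : IsFiniteMeasure ((gaussConv σ (μ : Measure E)).map e) := inferInstance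
  refine ext_of_forall_integral_eq_of_IsFiniteMeasure fun φ => ?_
  rw [hmap]
  have hb : ∀ x, |φ (e x)| ≤ ‖φ‖ := fun x => φ.norm_coe_le_norm (e x)
  -- Feller property: the kernel applied to φ is again an admissible test function, so both sides of
  -- the recursion converge weakly.
  let ψ : BoundedContinuousFunction E ℝ := .ofNormedAddCommGroup
    (gaussSmooth σ fun y => φ (e y))
    (continuous_gaussSmooth_of_continuous σ (φ.continuous.comp e.continuous) hb) ‖φ‖
    (abs_gaussSmooth_le σ hb)
  rw [ProbabilityMeasure.tendsto_iff_forall_integral_tendsto] at hlim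
  have h1 := (hlim φ).comp (tendsto_add_atTop_nat 1)
  refine tendsto_nhds_unique (hlim ψ) (h1.congr fun k => ?_)
  simp only [Function.comp_apply, hρ k]
  exact hmap _ φ

/-- The update is e(x_{k+1}) = x_k + √(2ε) z_k almost surely, and x_k is independent of z_k. -/
lemma IsPLA.map_succ {n : ℕ} {f : EuclideanSpace ℝ (Fin n) → ℝ} {ε : ℝ} {Ω : Type*}
    [MeasurableSpace Ω] {P : Measure Ω} [IsProbabilityMeasure P]
    {x z : ℕ → Ω → EuclideanSpace ℝ (Fin n)} (hx : IsPLA f ε P x z)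
    (e : EuclideanSpace ℝ (Fin n) ≃ₜ EuclideanSpace ℝ (Fin n)) (he : ∀ y, e y = y + ε • ∇ f y)
    (k : ℕ) :
    P.map (x (k + 1)) = (gaussConv (Real.sqrt (2 * ε)) (P.map (x k))).map e.symm := by
  set s := Real.sqrt (2 * ε)
  have hzm : AEMeasurable (z k) P := (hx.noise_law k).aemeasurable
  have hind : IndepFun (x k) (s • z k) P :=
    (hx.noise_indep k).comp
      (φ := fun v : Fin (k + 1) → EuclideanSpace ℝ (Fin n) => v (Fin.last k))
      (ψ := fun v => s • v) (measurable_pi_apply (Fin.last k)) (measurable_const_smul s)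
  have hsum : P.map (x k + s • z k) = gaussConv s (P.map (x k)) := by
    rw [hind.map_add_eq_map_conv_map₀ (hx.measurable k).aemeasurable (hzm.const_smul s), gaussConv,
      ← (hx.noise_law k).map_eq, AEMeasurable.map_map_of_aemeasurable
        (measurable_const_smul s).aemeasurable hzm]
    rfl
  rw [← hsum, AEMeasurable.map_map_of_aemeasurable e.symm.continuous.measurable.aemeasurable
    ((hx.measurable k).aemeasurable.add (hzm.const_smul s))]
  refine Measure.map_congr ?_
  filter_upwards [hx.update k] with w hw
  simp only [Function.comp_apply, Pi.add_apply, Pi.smul_apply]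
  rw [Homeomorph.eq_symm_apply, he]
  nth_rewrite 1 [hw]
  abel

end Laws

/-! ### Iteration along the algorithm and conclusion. -/

theorem theorem3 {n : ℕ} (f : EuclideanSpace ℝ (Fin n) → ℝ) (L β ε q : ℝ)
    (νε : ProbabilityMeasure (EuclideanSpace ℝ (Fin n)))
    {Ω : Type*} [MeasurableSpace Ω] (P : Measure Ω) [IsProbabilityMeasure P]
    (x z : ℕ → Ω → EuclideanSpace ℝ (Fin n))
    (hν : IsProbabilityMeasure (gibbsMeasure f))
    (hL : 0 < L) (hf : IsLSmooth f L)
    (hβ : 0 < β) (hε : 0 < ε) (hεlt : ε < min (1 / L) (1 / (2 * β)))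
    (hlim : IsBiasedLimit f ε νε) (hP : SatisfiesPoincare (νε : Measure (EuclideanSpace ℝ (Fin n))) β)
    (hq : 1 < q) (hx : IsPLA f ε P x z)
    (hfin : renyiDiv (2 * q) (P.map (x 0)) (νε : Measure (EuclideanSpace ℝ (Fin n))) ≠ ⊤)
    (k₀ : ℝ)
    (hk₀ : k₀ = 2 * q / (β * ε) *
      ((renyiDiv (2 * q) (P.map (x 0)) (νε : Measure (EuclideanSpace ℝ (Fin n)))).toReal - 1))
    (k : ℕ) (hk : k₀ ≤ k) :
    renyiDiv q (P.map (x k)) (gibbsMeasure f) ≤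
      (((q - 1 / 2) / (q - 1) * Real.exp (-(β * ε * (k - k₀)) / (2 * q)) : ℝ) : EReal)
        + renyiDiv (2 * q - 1) (νε : Measure (EuclideanSpace ℝ (Fin n))) (gibbsMeasure f) := by
  have hεL : ε * L < 1 := by
    have := hεlt.trans_le (min_le_left _ _)
    rwa [lt_div_iff₀ hL] at this
  have hβε : 2 * β * ε ≤ 1 := by
    have := hεlt.trans_le (min_le_right _ _)
    rw [lt_div_iff₀ (by positivity)] at this
    linarith
  obtain ⟨e, he⟩ := exists_homeomorph_id_add_smul hL.le hε.le hf.gradient_lipschitz hεL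
  have hstat : (gaussConv (Real.sqrt (2 * ε)) (νε : Measure (EuclideanSpace ℝ (Fin n)))).map e.symm
      = νε := by
    obtain ⟨Ω', _, P', _, x', z', ρ', hx', hρ', hρlim⟩ := hlim
    refine map_gaussConv_eq_of_tendsto _ e.symm (fun k => ?_) hρlim
    rw [← (hρ' (k + 1)).map_eq, ← (hρ' k).map_eq]
    exact hx'.map_succ e he k
  have hprob : ∀ j, IsProbabilityMeasure (P.map (x j)) := fun j =>
    Measure.isProbabilityMeasure_map (hx.measurable j).aemeasurable
  have hiter : ∀ j : ℕ, P.map (x j) ≪ νε ∧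
      ∫⁻ y, ((P.map (x j)).rnDeriv νε y) ^ (2 * q) ∂(νε : Measure (EuclideanSpace ℝ (Fin n)))
        ≤ ENNReal.ofReal (Real.exp ((2 * q - 1) * linExp
          ((renyiDiv (2 * q) (P.map (x 0)) νε).toReal - 1 - j * (β * ε / (2 * q))))) := by
    intro j
    induction j with
    | zero =>
      simpa using exists_lintegral_le_of_renyiDiv_ne_top (by linarith) hfin
    | succ j ih =>
      have hstep := renyi_gaussConv hβ hε hβε hP.poincareC1 (by linarith) ih.1 ih.2
      have hemb : MeasurableEmbedding e.symm := e.symm.measurableEmbedding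
      rw [hx.map_succ e he j]
      refine ⟨?_, ?_⟩
      · have := (gaussConv_absolutelyContinuous ih.1 (Real.sqrt (2 * ε))).map hemb.measurable
        rwa [hstat] at this
      -- Both convolved measures are pushed by e⁻¹, which preserves the integral; by stationarity
      -- the reference measure becomes ν_ε again.
      · have h1 := lintegral_rnDeriv_rpow_map hemb
          (gaussConv (Real.sqrt (2 * ε)) (P.map (x j)))
          (gaussConv (Real.sqrt (2 * ε)) (νε : Measure (EuclideanSpace ℝ (Fin n)))) (2 * q)
        rw [hstat] at h1
        rw [h1]
        refine hstep.trans_eq ?_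
        push_cast
        congr 4
        ring
  obtain ⟨hac, hV⟩ := hiter k
  -- k₀ is the time at which the profile parameter reaches 0 and `linExp` switches from its linear
  -- to its exponential branch.
  have hθ : (renyiDiv (2 * q) (P.map (x 0)) νε).toReal - 1 - k * (β * ε / (2 * q))
      = -(β * ε * (k - k₀)) / (2 * q) := by
    rw [hk₀]
    field_simp
    ring
  have hneg : -(β * ε * (k - k₀)) / (2 * q) ≤ 0 := by
    have : 0 ≤ β * ε * (k - k₀) := mul_nonneg (by positivity) (by linarith)
    exact div_nonpos_of_nonpos_of_nonneg (by linarith) (by linarith)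
  rw [hθ, linExp_of_nonpos hneg] at hV
  exact renyiDiv_le_of_lintegral_le hac hq hV
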